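/- Let $D, L, \ell \ge 1$ and $K \ge D$ be integers with $D \mid K$, let $N = DL+1$, and let $\mathbb{F}_q$ be any finite field. Messages $\mathbf{X}_1,\dots,\mathbf{X}_K$ are independent and uniform over $\mathbb{F}_q^{m}$ with $m = L\ell$, each message is divided into $L$ subpackets of $\ell$ symbols, and each of $N$ servers stores a copy of all messages. A demand $\mathbf{W}$ is uniform over the $D$-subsets of $\{1,\dots,K\}$ and independent of the messages. A linear multi-message private information retrieval (MPIR) protocol with subpacketization degree $L$ draws, given $\mathbf{W}=W$, (discrete) queries $\mathbf{Q}_1^{[W]},\dots,\mathbf{Q}_N^{[W]}$ at random, independently of the messages; server $n$ answers with a list $\mathbf{A}_n^{[W]}$ of linear combinations, with coefficients in $\mathbb{F}_q$ determined by its query, of the $KL$ message subpackets. The protocol must be private, i.e. $\mathbb{P}(\mathbf{W}=W^*\mid \mathbf{Q}_n^{[\mathbf{W}]}=Q)=\mathbb{P}(\mathbf{W}=W^*)$ for every server $n$, every $D$-subset $W^*$ and every query $Q$ of positive probability, and recoverable, i.e. $H(\mathbf{X}_W\mid \mathbf{A}^{[W]},\mathbf{Q}^{[W]})=0$ for every $W$,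 where $\mathbf{A}^{[W]}$ and $\mathbf{Q}^{[W]}$ are the collections of all answers and of all queries. Its rate is $H(\mathbf{X}_{\mathbf{W}})\big/\sum_{n=1}^N H(\mathbf{A}_n^{[\mathbf{W}]}\mid \mathbf{Q}_n^{[\mathbf{W}]})$, and the capacity is the supremum of the rates of all such protocols. Then the capacity equals $$C=\frac{1-1/N}{1-1/N^{K/D}}.$$ -/

import Mathlib

noncomputable section

namespace MPIR

/-! ### Discrete random variables: conditional probability and Shannon entropy (in bits) -/

/-- `ℙ(X = x | Y = y)` for random variables `X`, `Y` on the discrete probability space `(Ω, μ)`;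
meaningful when `ℙ(Y = y) ≠ 0`. -/
def condProb {Ω α β : Type*} (μ : PMF Ω) (X : Ω → α) (Y : Ω → β) (x : α) (y : β) : ENNReal :=
  μ.map (fun ω => (X ω, Y ω)) (x, y) / μ.map Y y

/-- The contribution `- p log₂ p` of an outcome of probability `p` to the entropy. -/
def bits (p : ENNReal) : ENNReal :=
  ENNReal.ofReal (Real.negMulLog p.toReal / Real.log 2)

/-- The Shannon entropy `H(X)`, in bits. -/
def entropy {Ω α : Type*} (μ : PMF Ω) (X : Ω → α) : ENNReal :=
  ∑' x, bits (μ.map X x)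

/-- The conditional Shannon entropy `H(X | Y) = ∑_y ℙ(Y = y) H(X | Y = y)`, in bits. -/
def condEntropy {Ω α β : Type*} (μ : PMF Ω) (X : Ω → α) (Y : Ω → β) : ENNReal :=
  ∑' y, μ.map Y y * ∑' x, bits (condProb μ X Y x y)

/-! ### Messages and demands -/

/-- The contents of the database: `K` messages, each consisting of `L` subpackets of `ℓ` symbols
of `F` (so each message has `m = L ℓ` symbols). -/
abbrev Messages (F : Type*) (K L ℓ : ℕ) := Fin K → Fin L → Fin ℓ → F

/-- The possible index sets of the demand messages: the `D`-subsets of the `K` indices. -/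
abbrev Demand (K D : ℕ) := {W : Finset (Fin K) // W.card = D}

theorem demand_nonempty {K D : ℕ} (h : D ≤ K) : Nonempty (Demand K D) := by
  obtain ⟨W, -, hW⟩ :=
    Finset.exists_subset_card_eq (s := (Finset.univ : Finset (Fin K))) (n := D) (by simpa using h)
  exact ⟨⟨W, hW⟩⟩

/-- The demand messages `X_W`, listed in increasing order of their indices. -/
def demandMessages {F : Type*} {K D L ℓ : ℕ} (W : Demand K D) (X : Messages F K L ℓ) :
    Fin D → Fin L → Fin ℓ → F :=
  fun i => X (W.1.orderEmbOfFin W.2 i)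

/-! ### Linear protocols -/

/-- The data of a linear protocol with `N` servers and subpacketization degree `L` over `F`.
Given the demand `W`, the user draws the queries to the `N` servers from the joint law
`queryLaw W`. A query `q` received by server `n` determines a list of coefficient vectors, indexed
by the `K L` message subpackets; the server's answer is the list of the corresponding linear
combinations of subpackets. -/
structure LinearProtocol (F : Type*) (K D N L : ℕ) where
  /-- the query alphabet -/
  Query : Type
  /-- the joint law of the queries to the `N` servers, given the demand -/
  queryLaw : Demand K D → PMF (Fin N → Query)
  /-- the coefficient vectors of the linear combinations that server `n` returns -/
  coeffs : Fin N → Query → List (Fin K → Fin L → F)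

namespace LinearProtocol

variable {F : Type*} [Field F] {K D N L : ℕ}

/-- The answer of server `n` to the query `q` when the database is `X`. -/
def answer {ℓ : ℕ} (P : LinearProtocol F K D N L) (n : Fin N) (q : P.Query)
    (X : Messages F K L ℓ) : List (Fin ℓ → F) :=
  (P.coeffs n q).map fun c => ∑ k, ∑ l, c k l • X k l

variable [Fintype F]

/-- The joint law of the queries and the messages given the demand `W`: the messages are
independent and uniform, and independent of the queries. -/
def lawGiven (P : LinearProtocol F K D N L) (ℓ : ℕ) (W : Demand K D) :
    PMF ((Fin N → P.Query) × Messages F K L ℓ) :=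
  (P.queryLaw W).bind fun Q =>
    (PMF.uniformOfFintype (Messages F K L ℓ)).map fun X => (Q, X)

/-- The joint law of the demand, the queries and the messages: the demand is uniform over all
`D`-subsets and independent of the messages. -/
def law (P : LinearProtocol F K D N L) (ℓ : ℕ) (hDK : D ≤ K) :
    PMF (Demand K D × (Fin N → P.Query) × Messages F K L ℓ) :=
  (@PMF.uniformOfFintype (Demand K D) _ (demand_nonempty hDK)).bind fun W =>
    (P.lawGiven ℓ W).map fun ω => (W, ω)

/-- Privacy: no query that a server may receive changes the distribution of the demand, i.e.
`ℙ(𝐖 = W | 𝐐ₙ = q) = ℙ(𝐖 = W)` for all `n`, `W` and all `q` with `ℙ(𝐐ₙ = q) ≠ 0`. -/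
def IsPrivate (P : LinearProtocol F K D N L) (ℓ : ℕ) (hDK : D ≤ K) : Prop :=
  ∀ (n : Fin N) (W : Demand K D) (q : P.Query),
    (P.law ℓ hDK).map (fun ω => ω.2.1 n) q ≠ 0 →
      condProb (P.law ℓ hDK) (fun ω => ω.1) (fun ω => ω.2.1 n) W q
        = (P.law ℓ hDK).map (fun ω => ω.1) W

/-- Recoverability: for every demand `W`, the demand messages are determined by the collection of
answers and the collection of queries, `H(X_W | A^[W], Q^[W]) = 0`. -/
def IsRecoverable (P : LinearProtocol F K D N L) (ℓ : ℕ) : Prop :=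
  ∀ W : Demand K D,
    condEntropy (P.lawGiven ℓ W) (fun ω => demandMessages W ω.2)
      (fun ω => ((fun n => P.answer n (ω.1 n) ω.2), ω.1)) = 0

/-- The rate: the entropy `H(X_𝐖)` of the demand messages divided by the expected total number of
downloaded bits `∑ₙ H(𝐀ₙ | 𝐐ₙ)`. -/
def rate (P : LinearProtocol F K D N L) (ℓ : ℕ) (hDK : D ≤ K) : ENNReal :=
  entropy (P.law ℓ hDK) (fun ω => demandMessages ω.1 ω.2.2) /
    ∑ n : Fin N, condEntropy (P.law ℓ hDK)
      (fun ω => P.answer n (ω.2.1 n) ω.2.2) (fun ω => ω.2.1 n)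

end LinearProtocol

/-- The capacity of linear multi-message private information retrieval with `N` servers, `K`
messages, `D` demand messages and subpacketization degree `L`, for subpackets of `ℓ` symbols
of `F`: the supremum of the rates of all private and recoverable linear protocols. -/
def capacity (F : Type*) [Field F] [Fintype F] {K D : ℕ} (hDK : D ≤ K) (N L ℓ : ℕ) : ENNReal :=
  ⨆ (P : LinearProtocol F K D N L) (_ : P.IsPrivate ℓ hDK) (_ : P.IsRecoverable ℓ), P.rate ℓ hDK

end MPIR

end

/-! The messages are uniform and the answers linear, so entropies are ranks: the rate is `D * L * ℓ`
divided by the expected total rank of the answers (`rate_eq`). Privacy says that the law of each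
single query does not depend on the demand (`isPrivate_iff`).

Converse. Let ρ(S) be the expected sum of the ranks of the individual answers when the messages in S
are set to zero. If a demand W is disjoint from S, revealing W as well lowers the joint rank by at
least `D * L * ℓ`, because the answers determine W. The joint rank is at most the sum of the
individual ranks and at least their average. Privacy makes ρ computable under any demand, so ρ(S) ≥
D L ℓ + ρ(S ∪ W) / N (`meanResidualRank_union_le`). Revealing K / D disjoint blocks one after
another bounds ρ(∅) below by D L ℓ times a geometric sum (`le_meanResidualRank`), which is the
claimed capacity inverted.

Achievability. Choose r ≥ 0 with (1 + r) ^ D = N. Each single query selects from each message,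
independently, nothing with probability 1 / (1 + r) and otherwise a uniform subpacket; the answer is
the sum of the selected subpackets. It costs ℓ symbols, except that the empty query, of probability
(1 + r) ^ (-K) = N ^ (-K / D), costs nothing; this meets the converse. The queries must be
correlated so as to be decodable. All servers share the selections from the undemanded messages. One
server returns this interference alone, and each of the other D L servers adds one demanded
subpacket, masked by reference subpackets of other demanded messages. Random masks that give every
server the required marginal are built in `exists_subset_laws` and `exists_separating_ensemble`. -/

namespace MPIR

universe u

open scoped ENNReal

/-! ### Entropy of discrete random variables and of linear images of uniform vectors -/

section Entropy

variable {Ω α β γ : Type*}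

theorem bits_zero : bits 0 = 0 := by simp [bits]

theorem bits_one : bits 1 = 0 := by simp [bits]

theorem eq_zero_or_eq_one_of_bits_eq_zero {p : ℝ≥0∞} (hp : p ≤ 1) (h : bits p = 0) :
    p = 0 ∨ p = 1 := by
  have hpt : p ≠ ∞ := ne_top_of_le_ne_top ENNReal.one_ne_top hp
  have h1 : p.toReal ≤ 1 := ENNReal.toReal_le_of_le_ofReal zero_le_one (by simpa using hp)
  have hlog : 0 < Real.log 2 := Real.log_pos one_lt_two
  rw [bits, ENNReal.ofReal_eq_zero] at h
  have h2 : Real.negMulLog p.toReal ≤ 0 := by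
    by_contra! hc
    exact absurd h (not_le.2 (div_pos hc hlog))
  by_contra! hne
  have h0 : 0 < p.toReal := ENNReal.toReal_pos hne.1 hpt
  have h3 : p.toReal < 1 := lt_of_le_of_ne h1 fun he => hne.2 <| by
    rw [← ENNReal.ofReal_toReal hpt, he, ENNReal.ofReal_one]
  have := mul_pos_of_neg_of_neg (neg_lt_zero.2 h0) (Real.log_neg h0 h3)
  rw [Real.negMulLog] at h2
  linarith

theorem map_apply_of_injective (p : PMF α) {g : α → β} (hg : Function.Injective g) (a : α) :
    p.map g (g a) = p a := by
  classical
  rw [PMF.map_apply, tsum_eq_single a]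
  · simp
  · intro b hb
    rw [if_neg fun h => hb (hg h).symm]

theorem map_apply_eq_zero (p : PMF α) {g : α → β} {b : β} (hb : b ∉ Set.range g) :
    p.map g b = 0 := by
  classical
  rw [PMF.map_apply]
  exact ENNReal.tsum_eq_zero.2 fun a => if_neg fun h => hb ⟨a, h.symm⟩

theorem tsum_bits_map_of_injective (p : PMF α) {g : α → β} (hg : Function.Injective g) :
    ∑' b, bits (p.map g b) = ∑' a, bits (p a) := by
  rw [← hg.tsum_eq]
  · simp_rw [map_apply_of_injective p hg]
  · intro b hb
    by_contra hc
    exact hb (by simp [map_apply_eq_zero p hc, bits_zero])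

theorem tsum_bits_pure (a : α) : ∑' b, bits (PMF.pure a b) = 0 := by
  classical
  refine ENNReal.tsum_eq_zero.2 fun b => ?_
  rw [PMF.pure_apply]
  split_ifs
  · exact bits_one
  · exact bits_zero

theorem tsum_bits_uniformOfFintype (α : Type*) [Fintype α] [Nonempty α] :
    ∑' a, bits (PMF.uniformOfFintype α a)
      = ENNReal.ofReal (Real.log (Fintype.card α) / Real.log 2) := by
  have hc : (0 : ℝ) < Fintype.card α := by exact_mod_cast Fintype.card_pos
  simp only [PMF.uniformOfFintype_apply, tsum_fintype, Finset.sum_const, Finset.card_univ, bits,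
    ENNReal.toReal_inv, ENNReal.toReal_natCast, Real.negMulLog, Real.log_inv, nsmul_eq_mul]
  rw [← ENNReal.ofReal_natCast, ← ENNReal.ofReal_mul hc.le]
  congr 1
  field_simp

/-- The fibres are translates of one another, so all values are equally likely. -/
theorem uniformOfFintype_map_of_surjective {G H : Type*} [AddGroup G] [AddGroup H] [Fintype G]
    [Fintype H] (f : G →+ H) (hf : Function.Surjective f) :
    (PMF.uniformOfFintype G).map f = PMF.uniformOfFintype H := by
  classical
  have hconst : ∀ y : H, (PMF.uniformOfFintype G).map f y = (PMF.uniformOfFintype G).map f 0 := by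
    intro y
    obtain ⟨x, rfl⟩ := hf y
    simp only [PMF.map_apply, PMF.uniformOfFintype_apply]
    rw [← (Equiv.addRight x).tsum_eq]
    refine tsum_congr fun a => ?_
    simp [eq_comm]
  have hsum := ((PMF.uniformOfFintype G).map f).tsum_coe
  simp only [hconst, tsum_fintype, Finset.sum_const, Finset.card_univ, nsmul_eq_mul] at hsum
  ext y
  rw [hconst, PMF.uniformOfFintype_apply]
  exact ENNReal.eq_inv_of_mul_eq_one_left (by rwa [mul_comm])

/-- A linear image of a uniform vector, encoded injectively, has entropy proportional to the
rank. -/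
theorem tsum_bits_map_linearMap {F V V' : Type*} [Field F] [Fintype F] [AddCommGroup V]
    [Module F V] [Fintype V] [AddCommGroup V'] [Module F V'] (T : V →ₗ[F] V') {g : V' → β}
    (hg : Function.Injective g) :
    ∑' b, bits ((PMF.uniformOfFintype V).map (g ∘ T) b)
      = Module.finrank F (LinearMap.range T)
        * ENNReal.ofReal (Real.log (Fintype.card F) / Real.log 2) := by
  classical
  have : Fintype (LinearMap.range T) := Fintype.ofFinite _
  have h1 : (g ∘ T) = (fun y : LinearMap.range T => g y) ∘ T.rangeRestrict := rfl
  have h2 : Function.Injective fun y : LinearMap.range T => g y :=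
    hg.comp Subtype.val_injective
  have h3 := uniformOfFintype_map_of_surjective T.rangeRestrict.toAddMonoidHom
    T.surjective_rangeRestrict
  have h4 : (PMF.uniformOfFintype V).map T.rangeRestrict
      = PMF.uniformOfFintype (LinearMap.range T) := h3
  rw [h1, ← PMF.map_comp, h4, tsum_bits_map_of_injective _ h2, tsum_bits_uniformOfFintype,
    Module.card_eq_pow_finrank (K := F), Nat.cast_pow, Real.log_pow, mul_div_assoc,
    ENNReal.ofReal_mul (Nat.cast_nonneg _), ENNReal.ofReal_natCast]

theorem bind_map_pair_apply (p : PMF β) (κ : β → PMF α) (x : α) (y : β) :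
    (p.bind fun b => (κ b).map fun a => (a, b)) (x, y) = p y * κ y x := by
  classical
  rw [PMF.bind_apply, tsum_eq_single y]
  · rw [map_apply_of_injective (κ y) (g := fun a => (a, y)) fun a b h => (Prod.ext_iff.1 h).1]
  · intro b hb
    rw [map_apply_eq_zero, mul_zero]
    rintro ⟨a, ha⟩
    exact hb (Prod.ext_iff.1 ha).2

/-- Once the joint law is disintegrated, the kernel is the conditional law wherever `p y ≠ 0`;
elsewhere its values are irrelevant because of the factor `p y`. -/
theorem condEntropy_of_map_pair_eq_bind {μ : PMF Ω} {X : Ω → α} {Y : Ω → β} {p : PMF β}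
    {κ : β → PMF α}
    (h : μ.map (fun ω => (X ω, Y ω)) = p.bind fun b => (κ b).map fun a => (a, b)) :
    condEntropy μ X Y = ∑' y, p y * ∑' x, bits (κ y x) := by
  have hY : μ.map Y = p := by
    have := congrArg (PMF.map Prod.snd) h
    have hc : ∀ b : β, (κ b).map (fun _ => b) = PMF.pure b := fun b => PMF.map_const _ b
    simpa [PMF.map_comp, PMF.map_bind, Function.comp_def, hc] using this
  refine tsum_congr fun y => ?_
  rw [hY]
  by_cases h0 : p y = 0
  · simp [h0]
  · congr 1
    refine tsum_congr fun x => ?_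
    rw [condProb, h, hY, bind_map_pair_apply, mul_comm, ENNReal.mul_div_cancel_right h0
      (p.apply_ne_top y)]

theorem map_congr_on_support {μ : PMF Ω} {f g : Ω → α} (h : ∀ ω ∈ μ.support, f ω = g ω) :
    μ.map f = μ.map g := by
  classical
  ext a
  simp only [PMF.map_apply]
  refine tsum_congr fun ω => ?_
  by_cases hω : ω ∈ μ.support
  · rw [h ω hω]
  · simp [(PMF.apply_eq_zero_iff μ ω).2 hω]

/-- `H(X | Y) = 0` as soon as `Y` determines `X` almost surely. -/
theorem condEntropy_eq_zero {μ : PMF Ω} {X : Ω → α} {Y : Ω → β}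
    (h : ∀ ω ∈ μ.support, ∀ ω' ∈ μ.support, Y ω = Y ω' → X ω = X ω') :
    condEntropy μ X Y = 0 := by
  classical
  obtain ⟨ω₀, -⟩ := μ.support_nonempty
  let f : β → α := fun y =>
    if hy : ∃ ω ∈ μ.support, Y ω = y then X hy.choose else X ω₀
  have hf : ∀ ω ∈ μ.support, X ω = f (Y ω) := by
    intro ω hω
    have hy : ∃ ω' ∈ μ.support, Y ω' = Y ω := ⟨ω, hω, rfl⟩
    simp only [f, dif_pos hy]
    exact h _ hω _ hy.choose_spec.1 hy.choose_spec.2.symm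
  have h1 : μ.map (fun ω => (X ω, Y ω))
      = (μ.map Y).bind fun b => (PMF.pure (f b)).map fun a => (a, b) := by
    rw [map_congr_on_support (g := fun ω => (f (Y ω), Y ω)) fun ω hω => by rw [hf ω hω]]
    simp only [PMF.pure_map, PMF.bind_map]
    rfl
  rw [condEntropy_of_map_pair_eq_bind h1]
  simp only [tsum_bits_pure, mul_zero, tsum_zero]

/-- If `H(X | Y) = 0` then `Y` determines `X` almost surely. -/
theorem eq_of_condEntropy_eq_zero {μ : PMF Ω} {X : Ω → α} {Y : Ω → β}
    (h : condEntropy μ X Y = 0) {ω ω' : Ω} (hω : ω ∈ μ.support) (hω' : ω' ∈ μ.support)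
    (hY : Y ω = Y ω') : X ω = X ω' := by
  classical
  by_contra hne
  set J := μ.map fun ω => (X ω, Y ω) with hJ
  have hsnd : μ.map Y = J.map Prod.snd := by rw [hJ, PMF.map_comp]; rfl
  have hpos : ∀ ω ∈ μ.support, J (X ω, Y ω) ≠ 0 := fun ω hω =>
    (PMF.mem_support_iff _ _).1 ((PMF.mem_support_map_iff _ _ _).2 ⟨ω, hω, rfl⟩)
  set P := μ.map Y (Y ω) with hP
  have hP0 : P ≠ 0 := (PMF.mem_support_iff _ _).1 ((PMF.mem_support_map_iff _ _ _).2 ⟨ω, hω, rfl⟩)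
  have hPt : P ≠ ∞ := PMF.apply_ne_top _ _
  have hle : ∀ s : Finset α, ∑ x ∈ s, J (x, Y ω) ≤ P := by
    intro s
    rw [hP, hsnd, PMF.map_apply]
    calc ∑ x ∈ s, J (x, Y ω)
        = ∑ z ∈ s.map ⟨fun x => (x, Y ω), fun a b h => (Prod.ext_iff.1 h).1⟩,
            if Y ω = z.2 then J z else 0 := by
          rw [Finset.sum_map]; exact Finset.sum_congr rfl fun x _ => (if_pos rfl).symm
      _ ≤ _ := ENNReal.sum_le_tsum _
  -- A conditional probability that contributes no entropy is 0 or 1, so each value attained on this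
  -- fibre carries the whole mass `P`; two distinct values would give `2 * P ≤ P`.
  have hcase : ∀ x, J (x, Y ω) ≠ 0 → J (x, Y ω) = P := by
    intro x hx
    have h1 := ENNReal.tsum_eq_zero.1 h (Y ω)
    have h2 := ENNReal.tsum_eq_zero.1 ((mul_eq_zero.1 h1).resolve_left hP0) x
    have hle1 := hle {x}
    rw [Finset.sum_singleton] at hle1
    rcases eq_zero_or_eq_one_of_bits_eq_zero
      (ENNReal.div_le_of_le_mul (by rw [one_mul]; exact hle1)) h2 with h3 | h3
    · rcases ENNReal.div_eq_zero_iff.1 h3 with h4 | h4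
      · exact absurd h4 hx
      · exact absurd h4 hPt
    · exact (ENNReal.div_eq_one_iff hP0 hPt).1 h3
  have h1 := hcase _ (hpos ω hω)
  have h2 := hcase (X ω') (by rw [hY]; exact hpos ω' hω')
  have h3 := hle {X ω, X ω'}
  rw [Finset.sum_pair hne, h1, h2] at h3
  have : P + P ≤ P + 0 := by simpa using h3
  exact hP0 (le_antisymm ((ENNReal.add_le_add_iff_left hPt).1 this) (zero_le))

theorem tsum_map_mul (p : PMF α) (f : α → β) (g : β → ℝ≥0∞) :
    ∑' b, p.map f b * g b = ∑' a, p a * g (f a) := by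
  classical
  simp only [PMF.map_apply, ← ENNReal.tsum_mul_right]
  rw [ENNReal.tsum_comm]
  refine tsum_congr fun a => ?_
  rw [tsum_eq_single (f a)]
  · simp
  · intro b hb
    simp [hb]

end Entropy

/-! ### Rate, privacy and recoverability in terms of ranks and query laws -/

namespace LinearProtocol

variable {F : Type*} [Field F] {K D N L ℓ : ℕ}

/-- The linear map sending the database to the entries of the answer of server `n` to `q`. -/
def answerMap (P : LinearProtocol F K D N L) (ℓ : ℕ) (n : Fin N) (q : P.Query) :
    Messages F K L ℓ →ₗ[F] (Fin (P.coeffs n q).length → Fin ℓ → F) where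
  toFun X i := ∑ k, ∑ l, (P.coeffs n q).get i k l • X k l
  map_add' X Y := by
    ext i
    simp [Finset.sum_add_distrib]
  map_smul' a X := by
    ext i
    simp [Finset.mul_sum, mul_left_comm]

theorem answer_eq_ofFn (P : LinearProtocol F K D N L) (n : Fin N) (q : P.Query) :
    P.answer (ℓ := ℓ) n q = List.ofFn ∘ P.answerMap ℓ n q := by
  funext X
  simp only [answer, Function.comp_apply, answerMap, LinearMap.coe_mk, AddHom.coe_mk]
  conv_lhs => rw [← List.ofFn_get (P.coeffs n q), List.map_ofFn]
  rfl

theorem answer_eq_iff (P : LinearProtocol F K D N L) (n : Fin N) (q : P.Query)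
    (X Y : Messages F K L ℓ) :
    P.answer n q X = P.answer n q Y ↔ P.answerMap ℓ n q X = P.answerMap ℓ n q Y := by
  rw [answer_eq_ofFn]
  exact List.ofFn_injective.eq_iff

variable [Fintype F]

/-- The marginal law of the query to server `n`, the demand being uniform. -/
noncomputable def queryMarginal (P : LinearProtocol F K D N L) (hDK : D ≤ K) (n : Fin N) :
    PMF P.Query :=
  (@PMF.uniformOfFintype (Demand K D) _ (demand_nonempty hDK)).bind fun W =>
    (P.queryLaw W).map fun Q => Q n

theorem law_map (P : LinearProtocol F K D N L) (hDK : D ≤ K) {α : Type*}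
    (f : Demand K D × (Fin N → P.Query) × Messages F K L ℓ → α) :
    (P.law ℓ hDK).map f
      = (@PMF.uniformOfFintype (Demand K D) _ (demand_nonempty hDK)).bind fun W =>
        (P.queryLaw W).bind fun Q =>
          (PMF.uniformOfFintype (Messages F K L ℓ)).map fun X => f (W, Q, X) := by
  simp only [law, lawGiven, PMF.map_bind, PMF.map_comp, Function.comp_def]

theorem law_map_query (P : LinearProtocol F K D N L) (hDK : D ≤ K) (n : Fin N) :
    (P.law ℓ hDK).map (fun ω => ω.2.1 n) = P.queryMarginal hDK n := by
  have hc : ∀ q : P.Query, (PMF.uniformOfFintype (Messages F K L ℓ)).map (fun _ => q)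
      = PMF.pure q := fun q => PMF.map_const _ q
  rw [law_map, queryMarginal]
  simp only [hc]
  rfl

/-- Given its query, an answer is a linear image of the uniform database, so its entropy is its rank
times the entropy of one symbol. -/
theorem condEntropy_answer (P : LinearProtocol F K D N L) (hDK : D ≤ K) (n : Fin N) :
    condEntropy (P.law ℓ hDK) (fun ω => P.answer n (ω.2.1 n) ω.2.2) (fun ω => ω.2.1 n)
      = (∑' q, P.queryMarginal hDK n q
          * Module.finrank F (LinearMap.range (P.answerMap ℓ n q)))
        * ENNReal.ofReal (Real.log (Fintype.card F) / Real.log 2) := by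
  have h : (P.law ℓ hDK).map (fun ω => (P.answer n (ω.2.1 n) ω.2.2, ω.2.1 n))
      = (P.queryMarginal hDK n).bind fun q =>
        ((PMF.uniformOfFintype (Messages F K L ℓ)).map (P.answer n q)).map fun a => (a, q) := by
    rw [law_map, queryMarginal]
    simp only [PMF.bind_bind, PMF.bind_map, PMF.map_comp, Function.comp_def]
  rw [condEntropy_of_map_pair_eq_bind h, ← ENNReal.tsum_mul_right]
  refine tsum_congr fun q => ?_
  rw [answer_eq_ofFn, tsum_bits_map_linearMap _ List.ofFn_injective, mul_assoc]

theorem entropy_demandMessages (P : LinearProtocol F K D N L) (hDK : D ≤ K) :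
    entropy (P.law ℓ hDK) (fun ω => demandMessages ω.1 ω.2.2)
      = (D * L * ℓ : ℕ) * ENNReal.ofReal (Real.log (Fintype.card F) / Real.log 2) := by
  have hW : ∀ W : Demand K D, (PMF.uniformOfFintype (Messages F K L ℓ)).map (demandMessages W)
      = PMF.uniformOfFintype (Fin D → Fin L → Fin ℓ → F) := by
    intro W
    let f : Messages F K L ℓ →+ (Fin D → Fin L → Fin ℓ → F) :=
      { toFun := demandMessages W, map_zero' := rfl, map_add' := fun _ _ => rfl }
    refine uniformOfFintype_map_of_surjective f fun Y => ?_
    refine ⟨fun k => Function.extend (W.1.orderEmbOfFin W.2) Y 0 k, ?_⟩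
    funext i
    exact (W.1.orderEmbOfFin W.2).injective.extend_apply Y 0 i
  have h : (P.law ℓ hDK).map (fun ω => demandMessages ω.1 ω.2.2)
      = PMF.uniformOfFintype (Fin D → Fin L → Fin ℓ → F) := by
    rw [law_map]
    have : ∀ W : Demand K D, (PMF.uniformOfFintype (Messages F K L ℓ)).map
        (fun X => demandMessages W X) = PMF.uniformOfFintype (Fin D → Fin L → Fin ℓ → F) := hW
    simp only [this, PMF.bind_const]
  rw [entropy, h, tsum_bits_uniformOfFintype]
  simp only [Fintype.card_pi, Finset.prod_const, Finset.card_univ, Fintype.card_fin, ← pow_mul]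
  rw [Nat.cast_pow, Real.log_pow, mul_div_assoc, ENNReal.ofReal_mul (Nat.cast_nonneg _),
    ENNReal.ofReal_natCast]
  congr 2
  ring

/-- Privacy means that the law of each query does not depend on the demand. -/
theorem isPrivate_iff (P : LinearProtocol F K D N L) (hDK : D ≤ K) :
    P.IsPrivate ℓ hDK
      ↔ ∀ n W, (P.queryLaw W).map (fun Q => Q n) = P.queryMarginal hDK n := by
  have hne := demand_nonempty hDK
  have hc : ∀ n : Fin N, ∀ W : Demand K D, ∀ q : P.Query,
      (PMF.uniformOfFintype (Messages F K L ℓ)).map (fun _ => (W, q)) = PMF.pure (W, q) :=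
    fun n W q => PMF.map_const _ (W, q)
  have hdem : (P.law ℓ hDK).map (fun ω => ω.1) = PMF.uniformOfFintype (Demand K D) := by
    rw [law_map]
    have hc : ∀ W : Demand K D, (PMF.uniformOfFintype (Messages F K L ℓ)).map (fun _ => W)
      = PMF.pure W := fun W => PMF.map_const _ W
    simp only [hc, PMF.bind_const, PMF.bind_pure]
  have hjoint : ∀ n W q, (P.law ℓ hDK).map (fun ω => (ω.1, ω.2.1 n)) (W, q)
      = PMF.uniformOfFintype (Demand K D) W * (P.queryLaw W).map (fun Q => Q n) q := by
    intro n W q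
    rw [← bind_map_pair_apply (PMF.uniformOfFintype (Demand K D))
      (fun W => (P.queryLaw W).map (fun Q => Q n)) q W,
      ← map_apply_of_injective _ Prod.swap_injective]
    congr 1
    rw [PMF.map_comp, law_map]
    simp only [Function.comp_def, Prod.swap, PMF.map_comp]
    congr 1
    funext W
    have hc : ∀ q : P.Query, (PMF.uniformOfFintype (Messages F K L ℓ)).map (fun _ => (q, W))
      = PMF.pure (q, W) := fun q => PMF.map_const _ (q, W)
    simp only [hc]
    rfl
  set u := (PMF.uniformOfFintype (Demand K D)) with hu
  have hu0 : ∀ W, u W ≠ 0 := fun W => by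
    simp [hu, PMF.uniformOfFintype_apply]
  simp only [IsPrivate, condProb, hdem, law_map_query]
  constructor
  · intro h n W
    ext q
    by_cases hq : P.queryMarginal hDK n q = 0
    · rw [hq]
      have := ENNReal.tsum_eq_zero.1 ((PMF.bind_apply _ _ _).symm.trans hq) W
      exact (mul_eq_zero.1 this).resolve_left (hu0 W)
    · have h1 := h n W q hq
      rw [hjoint, eq_comm, ENNReal.eq_div_iff hq (PMF.apply_ne_top _ _), mul_comm] at h1
      exact ((ENNReal.mul_right_inj (hu0 W) (PMF.apply_ne_top _ _)).1 h1).symm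
  · intro h n W q hq
    rw [hjoint, h n W, ENNReal.mul_div_cancel_right hq (PMF.apply_ne_top _ _)]

theorem mem_support_lawGiven (P : LinearProtocol F K D N L) (W : Demand K D)
    (ω : (Fin N → P.Query) × Messages F K L ℓ) :
    ω ∈ (P.lawGiven ℓ W).support ↔ ω.1 ∈ (P.queryLaw W).support := by
  obtain ⟨Q, X⟩ := ω
  simp [lawGiven, -PMF.mem_support_iff, Prod.ext_iff]

/-- Recoverability means that, for all queries of positive probability, the answers determine
the demand messages. -/
theorem isRecoverable_iff (P : LinearProtocol F K D N L) :
    P.IsRecoverable ℓ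
      ↔ ∀ W, ∀ Q ∈ (P.queryLaw W).support, ∀ X Y : Messages F K L ℓ,
        (∀ n, P.answer n (Q n) X = P.answer n (Q n) Y) → ∀ k ∈ W.1, X k = Y k := by
  have hdm : ∀ (W : Demand K D) (X Y : Messages F K L ℓ),
      demandMessages W X = demandMessages W Y ↔ ∀ k ∈ W.1, X k = Y k := by
    intro W X Y
    rw [funext_iff]
    simp only [demandMessages]
    constructor
    · intro h k hk
      rw [← Finset.mem_coe, ← Finset.range_orderEmbOfFin W.1 W.2] at hk
      obtain ⟨i, rfl⟩ := hk
      exact h i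
    · intro h i
      exact h _ (Finset.orderEmbOfFin_mem _ _ _)
  constructor
  · intro h W Q hQ X Y hXY
    rw [← hdm]
    exact eq_of_condEntropy_eq_zero (h W) (ω := (Q, X)) (ω' := (Q, Y))
      ((P.mem_support_lawGiven W _).2 hQ) ((P.mem_support_lawGiven W _).2 hQ)
      (Prod.ext (funext hXY) rfl)
  · intro h W
    refine condEntropy_eq_zero ?_
    rintro ⟨Q, X⟩ hω ⟨Q', Y⟩ - he
    obtain ⟨h1, rfl⟩ := Prod.ext_iff.1 he
    exact (hdm W X Y).2 (h W Q ((P.mem_support_lawGiven W _).1 hω) X Y (congrFun h1))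

end LinearProtocol

/-! ### Rank inequalities -/

section Rank

variable {F : Type*} [Field F] {K L ℓ : ℕ}

/-- The databases in which all messages with index in `S` vanish. -/
def vanishingOn (F : Type*) [Field F] {K : ℕ} (L ℓ : ℕ) (S : Finset (Fin K)) :
    Submodule F (Messages F K L ℓ) where
  carrier := {X | ∀ k ∈ S, X k = 0}
  add_mem' hX hY k hk := by simp [hX k hk, hY k hk]
  zero_mem' k _ := rfl
  smul_mem' a X hX k hk := by simp [hX k hk]

theorem mem_vanishingOn {S : Finset (Fin K)} {X : Messages F K L ℓ} :
    X ∈ vanishingOn F L ℓ S ↔ ∀ k ∈ S, X k = 0 := Iff.rfl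

theorem vanishingOn_empty : vanishingOn F L ℓ (∅ : Finset (Fin K)) = ⊤ := by
  ext X
  simp [mem_vanishingOn]

/-- The database with the given messages at the indices in `W`, and zero elsewhere. -/
def extendByZero (F : Type*) [Field F] {K : ℕ} (L ℓ : ℕ) (W : Finset (Fin K)) :
    (W → Fin L → Fin ℓ → F) →ₗ[F] Messages F K L ℓ where
  toFun Y k := if h : k ∈ W then Y ⟨k, h⟩ else 0
  map_add' Y Z := by
    funext k
    by_cases h : k ∈ W <;> simp [h]
  map_smul' a Y := by
    funext k
    by_cases h : k ∈ W <;> simp [h]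

/-- If `T X` determines the messages in `W`, revealing these messages lowers the rank of `T` by
their number of symbols. -/
theorem finrank_map_vanishingOn_union {V : Type*} [AddCommGroup V] [Module F V]
    (T : Messages F K L ℓ →ₗ[F] V) {S W : Finset (Fin K)} (hSW : Disjoint S W)
    (hT : ∀ X, T X = 0 → ∀ k ∈ W, X k = 0) :
    Module.finrank F ((vanishingOn F L ℓ (S ∪ W)).map T) + W.card * L * ℓ
      ≤ Module.finrank F ((vanishingOn F L ℓ S).map T) := by
  have hinj : Function.Injective (T ∘ₗ extendByZero F L ℓ W) := by
    rw [← LinearMap.ker_eq_bot, LinearMap.ker_eq_bot']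
    intro Y hY
    funext k
    have := hT _ hY k.1 k.2
    simpa [extendByZero] using this
  have hrange : Module.finrank F (LinearMap.range (T ∘ₗ extendByZero F L ℓ W))
      = W.card * L * ℓ := by
    rw [LinearMap.finrank_range_of_inj hinj]
    simp [Module.finrank_pi_fintype, mul_assoc]
  -- If a database vanishing on `S ∪ W` and one supported on `W` have the same image, their
  -- difference lies in the kernel of `T`, hence vanishes on `W`; so the second one is zero.
  have hinf : (vanishingOn F L ℓ (S ∪ W)).map T ⊓ LinearMap.range (T ∘ₗ extendByZero F L ℓ W)
      = ⊥ := by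
    rw [eq_bot_iff]
    rintro _ ⟨⟨X, hX, rfl⟩, ⟨Y, hY⟩⟩
    have h0 : T (X - extendByZero F L ℓ W Y) = 0 := by
      rw [map_sub, sub_eq_zero]
      exact hY.symm
    have hY0 : Y = 0 := by
      funext k
      have h1 := hT _ h0 k.1 k.2
      have h2 : X k.1 = 0 := hX k.1 (Finset.mem_union_right _ k.2)
      simpa [extendByZero, h2] using h1
    rw [← hY, hY0, map_zero]
    exact Submodule.zero_mem _
  have hle : (vanishingOn F L ℓ (S ∪ W)).map T ⊔ LinearMap.range (T ∘ₗ extendByZero F L ℓ W)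
      ≤ (vanishingOn F L ℓ S).map T := by
    refine sup_le (Submodule.map_mono fun X hX k hk => hX k (Finset.mem_union_left _ hk)) ?_
    rintro _ ⟨Y, rfl⟩
    refine ⟨extendByZero F L ℓ W Y, fun k hk => ?_, rfl⟩
    exact dif_neg (Finset.disjoint_left.1 hSW hk)
  have hsum := Submodule.finrank_sup_add_finrank_inf_eq
    ((vanishingOn F L ℓ (S ∪ W)).map T) (LinearMap.range (T ∘ₗ extendByZero F L ℓ W))
  rw [hinf, finrank_bot, add_zero, hrange] at hsum
  rw [← hsum]
  exact Submodule.finrank_mono hle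

theorem finrank_map_pi_le {ι M : Type*} [Fintype ι] [AddCommGroup M] [Module F M]
    [FiniteDimensional F M] {V : ι → Type*} [∀ i, AddCommGroup (V i)] [∀ i, Module F (V i)]
    (T : ∀ i, M →ₗ[F] V i) (E : Submodule F M) :
    Module.finrank F (E.map (LinearMap.pi T)) ≤ ∑ i, Module.finrank F (E.map (T i)) := by
  let g : E.map (LinearMap.pi T) →ₗ[F] ∀ i, E.map (T i) :=
    LinearMap.pi fun i => (LinearMap.proj i).restrict (p := E.map (LinearMap.pi T)) <| by
      rintro _ ⟨X, hX, rfl⟩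
      exact ⟨X, hX, rfl⟩
  have hg : Function.Injective g := by
    intro y z h
    ext i
    exact congrArg Subtype.val (congrFun h i)
  rw [← Module.finrank_pi_fintype]
  exact LinearMap.finrank_le_finrank_of_injective hg

theorem finrank_map_le_finrank_map_pi {ι M : Type*} [AddCommGroup M] [Module F M]
    [FiniteDimensional F M] {V : ι → Type*} [∀ i, AddCommGroup (V i)] [∀ i, Module F (V i)]
    (T : ∀ i, M →ₗ[F] V i) (E : Submodule F M) (i : ι) :
    Module.finrank F (E.map (T i)) ≤ Module.finrank F (E.map (LinearMap.pi T)) := by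
  have h : E.map (T i) = (E.map (LinearMap.pi T)).map (LinearMap.proj i) := by
    rw [← Submodule.map_comp, LinearMap.proj_pi]
  rw [h]
  exact Submodule.finrank_map_le _ _

end Rank

/-! ### The converse bound -/

namespace LinearProtocol

variable {F : Type*} [Field F] {K D N L ℓ : ℕ}

/-- The number of independent symbols that the answer of server `n` to `q` reveals to someone who
knows the messages in `S`. -/
noncomputable def residualRank (P : LinearProtocol F K D N L) (ℓ : ℕ) (n : Fin N) (q : P.Query)
    (S : Finset (Fin K)) : ℕ :=
  Module.finrank F ((vanishingOn F L ℓ S).map (P.answerMap ℓ n q))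

theorem residualRank_empty (P : LinearProtocol F K D N L) (n : Fin N) (q : P.Query) :
    P.residualRank ℓ n q ∅ = Module.finrank F (LinearMap.range (P.answerMap ℓ n q)) := by
  rw [residualRank, vanishingOn_empty, Submodule.map_top]

/-- The joint rank of all answers mediates. It drops by the size of `W` when `W` is revealed;
before, it is at most the sum of the individual ranks, and after, it is at least each of them. The
factor `N` avoids averaging in the natural numbers. -/
theorem sum_residualRank_union_le (P : LinearProtocol F K D N L) {S W : Finset (Fin K)}
    (hSW : Disjoint S W) (Q : Fin N → P.Query)
    (hQ : ∀ X Y : Messages F K L ℓ,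
      (∀ n, P.answer n (Q n) X = P.answer n (Q n) Y) → ∀ k ∈ W, X k = Y k) :
    N * (W.card * L * ℓ) + ∑ n, P.residualRank ℓ n (Q n) (S ∪ W)
      ≤ N * ∑ n, P.residualRank ℓ n (Q n) S := by
  let T := fun n => P.answerMap ℓ n (Q n)
  have hT : ∀ X, LinearMap.pi T X = 0 → ∀ k ∈ W, X k = 0 := by
    intro X hX
    refine hQ X 0 fun n => ?_
    rw [answer_eq_iff, map_zero]
    exact congrFun hX n
  have h1 := finrank_map_vanishingOn_union (LinearMap.pi T) hSW hT
  have h2 := finrank_map_pi_le T (vanishingOn F L ℓ S)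
  have h3 : ∑ n, P.residualRank ℓ n (Q n) (S ∪ W)
      ≤ N * Module.finrank F ((vanishingOn F L ℓ (S ∪ W)).map (LinearMap.pi T)) := by
    refine (Finset.sum_le_card_nsmul _ _ _ fun n _ =>
      finrank_map_le_finrank_map_pi T (vanishingOn F L ℓ (S ∪ W)) n).trans ?_
    simp
  calc _ ≤ N * (W.card * L * ℓ)
        + N * Module.finrank F ((vanishingOn F L ℓ (S ∪ W)).map (LinearMap.pi T)) := by gcongr
    _ = N * (Module.finrank F ((vanishingOn F L ℓ (S ∪ W)).map (LinearMap.pi T))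
        + W.card * L * ℓ) := by ring
    _ ≤ _ := Nat.mul_le_mul_left _ (h1.trans h2)

variable [Fintype F]

/-- The expected total residual rank of the answers, given the messages in `S`. -/
noncomputable def meanResidualRank (P : LinearProtocol F K D N L) (ℓ : ℕ) (hDK : D ≤ K)
    (S : Finset (Fin K)) : ℝ≥0∞ :=
  ∑ n, ∑' q, P.queryMarginal hDK n q * P.residualRank ℓ n q S

/-- Only the marginal laws of the queries enter the mean, and by privacy these may be taken under
the demand `W` itself, whose recoverability gives the inequality for every query tuple of positive
probability. -/
theorem meanResidualRank_union_le (P : LinearProtocol F K D N L) (hDK : D ≤ K)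
    (hpriv : P.IsPrivate ℓ hDK) (hrec : P.IsRecoverable ℓ) {S : Finset (Fin K)} (W : Demand K D)
    (hSW : Disjoint S W.1) :
    N * ((D * L * ℓ : ℕ) : ℝ≥0∞) + P.meanResidualRank ℓ hDK (S ∪ W.1)
      ≤ N * P.meanResidualRank ℓ hDK S := by
  have hmean : ∀ S, P.meanResidualRank ℓ hDK S
      = ∑' Q, P.queryLaw W Q * ((∑ n, P.residualRank ℓ n (Q n) S : ℕ) : ℝ≥0∞) := by
    intro S
    simp only [meanResidualRank, ← (P.isPrivate_iff hDK).1 hpriv _ W, tsum_map_mul, Nat.cast_sum,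
      Finset.mul_sum]
    rw [Summable.tsum_finsetSum fun _ _ => ENNReal.summable]
  rw [hmean, hmean, ← ENNReal.tsum_mul_left]
  calc _ = ∑' Q, P.queryLaw W Q * (((N * (D * L * ℓ) : ℕ) : ℝ≥0∞)
        + ((∑ n, P.residualRank ℓ n (Q n) (S ∪ W.1) : ℕ) : ℝ≥0∞)) := by
        simp only [mul_add]
        rw [ENNReal.tsum_add, ENNReal.tsum_mul_right, PMF.tsum_coe, one_mul,
          Nat.cast_mul N]
    _ ≤ _ := by
        refine ENNReal.tsum_le_tsum fun Q => ?_
        by_cases hQ : Q ∈ (P.queryLaw W).support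
        · have := P.sum_residualRank_union_le hSW Q (P.isRecoverable_iff.1 hrec W Q hQ)
          rw [W.2] at this
          rw [mul_left_comm (N : ℝ≥0∞)]
          refine mul_le_mul_right ?_ _
          exact_mod_cast this
        · simp [(PMF.apply_eq_zero_iff _ Q).2 hQ]

/-- Induction on the number `j` of blocks of `D` messages not yet revealed: each further block costs
a factor `1 / N`. -/
theorem le_meanResidualRank (P : LinearProtocol F K D N L) (hDK : D ≤ K)
    (hpriv : P.IsPrivate ℓ hDK) (hrec : P.IsRecoverable ℓ) (hN : 0 < N) (j : ℕ)
    (S : Finset (Fin K)) (hS : S.card + j * D = K) :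
    ((D * L * ℓ : ℕ) : ℝ≥0∞) * ∑ i ∈ Finset.range j, (N : ℝ≥0∞)⁻¹ ^ i
      ≤ P.meanResidualRank ℓ hDK S := by
  have hN0 : (N : ℝ≥0∞) ≠ 0 := by exact_mod_cast hN.ne'
  have hNt : (N : ℝ≥0∞) ≠ ∞ := ENNReal.natCast_ne_top N
  induction j generalizing S with
  | zero => simp
  | succ j ih =>
    have hc : D ≤ (Sᶜ).card := by
      rw [Finset.card_compl, Fintype.card_fin]
      rw [add_mul, one_mul] at hS
      omega
    obtain ⟨W, hWS, hW⟩ := Finset.exists_subset_card_eq hc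
    have hdis : Disjoint S W :=
      Finset.disjoint_left.2 fun k hk hkW => Finset.mem_compl.1 (hWS hkW) hk
    have h1 := ih (S ∪ W) (by rw [Finset.card_union_of_disjoint hdis, hW]; linarith)
    have h2 := P.meanResidualRank_union_le hDK hpriv hrec ⟨W, hW⟩ hdis
    rw [← ENNReal.mul_le_mul_iff_right hN0 hNt]
    refine le_trans ?_ h2
    rw [Finset.sum_range_succ', pow_zero, mul_add, mul_add, mul_one, add_comm]
    refine add_le_add le_rfl (le_trans (le_of_eq ?_) h1)
    simp only [pow_succ]
    rw [← Finset.sum_mul, mul_left_comm, mul_comm (N : ℝ≥0∞), mul_assoc _ _ (N : ℝ≥0∞),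
      ENNReal.inv_mul_cancel hN0 hNt, mul_one]

/-- The entropy of one symbol is positive and finite, so it cancels. -/
theorem rate_eq (P : LinearProtocol F K D N L) (hDK : D ≤ K) :
    P.rate ℓ hDK = ((D * L * ℓ : ℕ) : ℝ≥0∞) / P.meanResidualRank ℓ hDK ∅ := by
  have hlog : 0 < Real.log (Fintype.card F) / Real.log 2 :=
    div_pos (Real.log_pos (by exact_mod_cast Fintype.one_lt_card)) (Real.log_pos one_lt_two)
  simp only [rate, entropy_demandMessages, condEntropy_answer, ← residualRank_empty,
    ← Finset.sum_mul]
  exact ENNReal.mul_div_mul_right _ _ (by simpa using hlog) ENNReal.ofReal_ne_top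

theorem rate_le (P : LinearProtocol F K D N L) (hDK : D ≤ K)
    (hpriv : P.IsPrivate ℓ hDK) (hrec : P.IsRecoverable ℓ) (hN : 0 < N)
    (hD : 0 < D) (hdvd : D ∣ K) :
    P.rate ℓ hDK ≤ (∑ i ∈ Finset.range (K / D), (N : ℝ≥0∞)⁻¹ ^ i)⁻¹ := by
  have h := P.le_meanResidualRank hDK hpriv hrec hN (K / D) ∅
    (by rw [Finset.card_empty, zero_add, Nat.div_mul_cancel hdvd])
  have hK : 0 < K / D := Nat.div_pos hDK hD
  have h0 : (∑ i ∈ Finset.range (K / D), (N : ℝ≥0∞)⁻¹ ^ i) ≠ 0 := by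
    intro h
    simpa using Finset.sum_eq_zero_iff.1 h 0 (Finset.mem_range.2 hK)
  have ht : (∑ i ∈ Finset.range (K / D), (N : ℝ≥0∞)⁻¹ ^ i) ≠ ∞ :=
    ENNReal.sum_ne_top.2 fun i _ => ENNReal.pow_ne_top (by simpa using hN.ne')
  rw [rate_eq]
  refine ENNReal.div_le_of_le_mul ?_
  rwa [mul_comm _⁻¹, ← div_eq_mul_inv, ENNReal.le_div_iff_mul_le (Or.inl h0) (Or.inl ht)]

end LinearProtocol

/-! ### Probability laws for the random masks -/

section SubsetLaws

/-- This is the binomial theorem `∑ B, x ^ B.card = (1 + x) ^ S.card` integrated from 0 to `r`. -/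
theorem sum_powerset_pow_succ_div {ι : Type*} (S : Finset ι) (r : ℝ) :
    ∑ B ∈ S.powerset, r ^ (B.card + 1) / (B.card + 1)
      = ((1 + r) ^ (S.card + 1) - 1) / (S.card + 1) := by
  have hn : ((S.card : ℝ) + 1) ≠ 0 := by positivity
  have hbin : (1 + r) ^ (S.card + 1)
      = ∑ m ∈ Finset.range (S.card + 1), r ^ (m + 1) * (S.card + 1).choose (m + 1) + 1 := by
    rw [add_comm 1 r, add_pow, Finset.sum_range_succ']
    simp
  rw [Finset.sum_powerset_apply_card (fun m => r ^ (m + 1) / ((m : ℝ) + 1)), hbin,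
    add_sub_cancel_right, Finset.sum_div]
  refine Finset.sum_congr rfl fun m _ => ?_
  have h : ((S.card : ℝ) + 1) * S.card.choose m = (S.card + 1).choose (m + 1) * ((m : ℝ) + 1) := by
    exact_mod_cast Nat.add_one_mul_choose_eq S.card m
  rw [nsmul_eq_mul]
  field_simp
  linear_combination r ^ (m + 1) * h

/-- The weights `c` and `d` scale the laws of the two kinds of masks in `exists_subset_laws`. The
two upper bounds say that the scaled masses of the nonempty sets do not exceed 1. -/
theorem exists_mixing_weights {D L : ℕ} (hL : 0 < L) {r : ℝ}
    (hrD : (1 + r) ^ D = D * L + 1) :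
    ∃ c d : ℝ, 0 ≤ c ∧ 0 ≤ d ∧ c + (L - 1) * d = 1
      ∧ c * (((1 + r) ^ (D + 1) - 1) / (D + 1) - r) ≤ 1 ∧ d * (L - r) ≤ 1 := by
  have hL1 : (1 : ℝ) ≤ L := by exact_mod_cast hL
  have hD1 : (0 : ℝ) < D + 1 := by positivity
  have hS : ((1 + r) ^ (D + 1) - 1) / (D + 1) - r = D * (L + (L - 1) * r) / (D + 1) := by
    rw [pow_succ, hrD]
    field_simp
    ring
  rw [hS]
  rcases eq_or_lt_of_le hL1 with h1 | h1
  -- For `L = 1` there are only reference subpackets, and `c = 1` is forced.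
  · refine ⟨1, 0, zero_le_one, le_rfl, by ring, ?_, by simp⟩
    rw [← h1, one_mul, div_le_one hD1]
    linarith
  rcases le_or_gt 1 r with h2 | h2
  · refine ⟨0, 1 / (L - 1), le_rfl, by have := sub_pos.2 h1; positivity, ?_, by simp, ?_⟩
    · have := (sub_pos.2 h1).ne'
      field_simp
      ring
    · rw [one_div, inv_mul_le_one₀ (sub_pos.2 h1)]
      linarith
  · have h3 : 0 < L - r := by linarith
    -- Here `d = 1 / (L - 1)` could be too large; `d` is taken as large as its bound allows, and `c`
    -- follows.
    refine ⟨(1 - r) / (L - r), 1 / (L - r), div_nonneg (by linarith) h3.le, by positivity, ?_, ?_,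
      ?_⟩
    · field_simp
      ring
    · rw [div_mul_div_comm, div_le_one (by positivity)]
      have hD0 : (0 : ℝ) ≤ D := Nat.cast_nonneg D
      have := mul_nonneg (mul_nonneg hD0 (sub_pos.2 h1).le) (sq_nonneg r)
      nlinarith
    · rw [one_div, inv_mul_cancel₀ h3.ne']

/-- Add to the weights `g` on nonempty sets the mass on `∅` that makes the total `1`. -/
def completeAtEmpty {D : ℕ} (g : Finset (Fin D) → ℝ) (B : Finset (Fin D)) : ℝ :=
  if B = ∅ then 1 - ∑ C ∈ Finset.univ.erase ∅, g C else g B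

theorem sum_completeAtEmpty {D : ℕ} (g : Finset (Fin D) → ℝ) : ∑ B, completeAtEmpty g B = 1 := by
  rw [← Finset.add_sum_erase _ _ (Finset.mem_univ ∅)]
  have : ∑ B ∈ Finset.univ.erase ∅, completeAtEmpty g B = ∑ C ∈ Finset.univ.erase ∅, g C :=
    Finset.sum_congr rfl fun B hB => if_neg (Finset.ne_of_mem_erase hB)
  rw [this, completeAtEmpty, if_pos rfl, sub_add_cancel]

theorem completeAtEmpty_nonneg {D : ℕ} {g : Finset (Fin D) → ℝ} (hg : ∀ B, 0 ≤ g B)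
    (h : ∑ C ∈ Finset.univ.erase ∅, g C ≤ 1) (B : Finset (Fin D)) : 0 ≤ completeAtEmpty g B := by
  rw [completeAtEmpty]
  split_ifs
  · linarith
  · exact hg B

/-- Here `p` is the law of `R`, and `m j` that of the mask of the non-reference subpackets of
message `j`. The last identity is what makes the contributions of the `B.card + 1` messages of a
selection add up to a power of `r`. On nonempty sets, `p` and `m j` are multiples of its right side,
with mixing weights `c` and `d`; the mass left over goes to the empty set. -/
theorem exists_subset_laws {D L : ℕ} (hD : 0 < D) (hL : 0 < L) {r : ℝ} (hr : 0 ≤ r)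
    (hrD : (1 + r) ^ D = D * L + 1) :
    ∃ (p : Finset (Fin D) → ℝ) (m : Fin D → Finset (Fin D) → ℝ),
      (∀ B, 0 ≤ p B) ∧ ∑ B, p B = 1 ∧ (∀ j B, 0 ≤ m j B) ∧ (∀ j, ∑ B, m j B = 1)
      ∧ (∀ j B, j ∈ B → m j B = 0)
      ∧ ∀ j B, j ∉ B → (∑ R, if (if j ∈ R then ∅ else R) = B then p R else 0) + (L - 1) * m j B
          = r ^ (B.card + 1) / (B.card + 1) := by
  have hD0 : (0 : ℝ) < D := by exact_mod_cast hD
  obtain ⟨c, d, hc, hd, hcd, hcS, hdS⟩ := exists_mixing_weights hL hrD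
  let h : Finset (Fin D) → ℝ := fun B => r ^ (B.card + 1) / (B.card + 1)
  have hh : ∀ B, 0 ≤ h B := fun B => by positivity
  have hsum : ∑ B ∈ Finset.univ.erase ∅, h B = ((1 + r) ^ (D + 1) - 1) / (D + 1) - r := by
    have := sum_powerset_pow_succ_div (Finset.univ : Finset (Fin D)) r
    rw [Finset.powerset_univ, ← Finset.add_sum_erase _ _ (Finset.mem_univ ∅)] at this
    simp only [Finset.card_empty, Finset.card_univ, Fintype.card_fin, Nat.cast_zero, zero_add,
      pow_one, div_one] at this
    simp only [h]
    linarith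
  -- The sets avoiding `j` have total weight `((1 + r) ^ D - 1) / D = L`, of which the empty set has
  -- `r`.
  have hsum' : ∀ j : Fin D, ∑ B ∈ Finset.univ.erase ∅, (if j ∈ B then 0 else h B) = L - r := by
    intro j
    have := sum_powerset_pow_succ_div (Finset.univ.erase j : Finset (Fin D)) r
    rw [Finset.card_erase_of_mem (Finset.mem_univ j), Finset.card_univ, Fintype.card_fin,
      Nat.sub_add_cancel hD, hrD, Nat.cast_sub hD, Nat.cast_one, sub_add_cancel,
      add_sub_cancel_right, mul_div_cancel_left₀ _ hD0.ne',
      ← Finset.add_sum_erase _ _ (Finset.mem_powerset.2 (Finset.empty_subset _))] at this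
    simp only [Finset.card_empty, Nat.cast_zero, zero_add, pow_one, div_one] at this
    rw [← Finset.sum_filter_add_sum_filter_not _ (fun B => j ∈ B),
      Finset.sum_eq_zero fun B hB => if_pos (Finset.mem_filter.1 hB).2, zero_add,
      eq_sub_iff_add_eq', ← this]
    congr 1
    refine Finset.sum_congr ?_ fun B hB => ?_
    · ext B
      simp [Finset.subset_erase]
    · exact if_neg fun hj => by simp [Finset.subset_erase, hj] at hB
  refine ⟨completeAtEmpty fun B => c * h B,
    fun j => completeAtEmpty fun B => d * if j ∈ B then 0 else h B,
    completeAtEmpty_nonneg (fun B => mul_nonneg hc (hh B)) ?_, sum_completeAtEmpty _,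
    fun j => completeAtEmpty_nonneg (fun B => mul_nonneg hd ?_) ?_,
    fun j => sum_completeAtEmpty _, ?_, ?_⟩
  · rwa [← Finset.mul_sum, hsum]
  · split_ifs
    · exact le_rfl
    · exact hh B
  · rwa [← Finset.mul_sum, hsum']
  · intro j B hj
    simp only [completeAtEmpty]
    rw [if_neg (Finset.ne_empty_of_mem hj), if_pos hj, mul_zero]
  · intro j B hj
    -- The case of the empty set is not imposed by the choice of weights: it follows from the
    -- normalisations, as `L - (L - r) * (c + (L - 1) * d) = r`.
    by_cases hB : B = ∅
    · subst hB
      have h1 : (∑ R, if (if j ∈ R then ∅ else R) = (∅ : Finset (Fin D))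
          then completeAtEmpty (fun B => c * h B) R else 0) = 1 - c * (L - r) := by
        rw [← sum_completeAtEmpty fun B => c * h B, ← hsum' j, Finset.mul_sum, eq_sub_iff_add_eq,
          ← Finset.add_sum_erase _ _ (Finset.mem_univ ∅),
          ← Finset.add_sum_erase _ _ (Finset.mem_univ ∅), add_assoc, ← Finset.sum_add_distrib]
        refine congrArg₂ _ (by simp) ?_
        · refine Finset.sum_congr rfl fun R hR => ?_
          have hR0 := Finset.ne_of_mem_erase hR
          by_cases hjR : j ∈ R <;> simp [hjR, hR0, completeAtEmpty]
      simp only [h1]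
      rw [completeAtEmpty, if_pos rfl, ← Finset.mul_sum, hsum']
      simp only [Finset.card_empty, Nat.cast_zero, zero_add, pow_one, div_one]
      linear_combination (-(L - r)) * hcd
    · rw [Finset.sum_eq_single B]
      · simp only [completeAtEmpty, hB, hj, if_false, if_true]
        linear_combination h B * hcd
      · intro R _ hRB
        refine if_neg ?_
        split_ifs
        · exact Ne.symm hB
        · exact hRB
      · simp

end SubsetLaws

/-! ### Decodable families of selections with product marginals -/

section Ensemble

variable {D L N : ℕ}

/-- The combination of subpackets selected by `v`, which names at most one subpacket of each
message. -/
def selectSum {ι : Type*} [Fintype ι] {L : ℕ} {M : Type*} [AddCommGroup M]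
    (v : ι → Option (Fin L)) (X : ι → Fin L → M) : M :=
  ∑ i, (v i).elim 0 (X i)

/-- The selections `a n` separate the subpackets, even up to an unknown common summand. -/
def Separates (a : Fin N → Fin D → Option (Fin L)) : Prop :=
  ∀ (M : Type u) [AddCommGroup M] (X : Fin D → Fin L → M) (y : M),
    (∀ n, selectSum (a n) X + y = 0) → X = 0

/-- The messages whose reference subpackets mask subpacket `l` of message `j`. The reference
subpacket of message `i` is `(f i).1`; reference subpackets outside `R` are masked by `R`, and the
other subpackets of message `j` are masked by `(f j).2`. -/
def maskSet (R : Finset (Fin D)) (f : Fin D → Fin L × Finset (Fin D)) (j : Fin D) (l : Fin L) :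
    Finset (Fin D) :=
  if l = (f j).1 then (if j ∈ R then ∅ else R) else (f j).2

/-- The empty selection, and for each subpacket the selection of it together with its mask. -/
def maskedSelection (R : Finset (Fin D)) (f : Fin D → Fin L × Finset (Fin D)) :
    Option (Fin D × Fin L) → Fin D → Option (Fin L)
  | none => fun _ => none
  | some (j, l) => fun i =>
      if i = j then some l else if i ∈ maskSet R f j l then some (f i).1 else none

theorem selectSum_maskedSelection {M : Type*} [AddCommGroup M] (R : Finset (Fin D))
    (f : Fin D → Fin L × Finset (Fin D)) (j : Fin D) (l : Fin L) (X : Fin D → Fin L → M) :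
    selectSum (maskedSelection R f (some (j, l))) X
      = X j l + ∑ i ∈ (maskSet R f j l).erase j, X i (f i).1 := by
  rw [selectSum, ← Finset.add_sum_erase _ _ (Finset.mem_univ j)]
  congr 1
  · simp [maskedSelection]
  · have hsub : (maskSet R f j l).erase j ⊆ Finset.univ.erase j :=
      Finset.erase_subset_erase _ (Finset.subset_univ _)
    rw [← Finset.sum_subset hsub]
    · refine Finset.sum_congr rfl fun i hi => ?_
      simp [maskedSelection, Finset.ne_of_mem_erase hi, Finset.mem_of_mem_erase hi]
    · intro i hi hi'
      have hij := Finset.ne_of_mem_erase hi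
      have : i ∉ maskSet R f j l := fun h => hi' (Finset.mem_erase.2 ⟨hij, h⟩)
      simp [maskedSelection, hij, this]

/-- Decoding has three stages: the references in `R` are unmasked, the other references are masked
only by those in `R`, and all remaining subpackets are masked only by references. -/
theorem eq_zero_of_maskedSelection {M : Type*} [AddCommGroup M] (R : Finset (Fin D))
    (f : Fin D → Fin L × Finset (Fin D)) (X : Fin D → Fin L → M)
    (h : ∀ j l, selectSum (maskedSelection R f (some (j, l))) X = 0) : X = 0 := by
  simp only [selectSum_maskedSelection] at h
  have h1 : ∀ j ∈ R, X j (f j).1 = 0 := by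
    intro j hj
    simpa [maskSet, hj] using h j (f j).1
  have h2 : ∀ j, X j (f j).1 = 0 := by
    intro j
    by_cases hj : j ∈ R
    · exact h1 j hj
    · have h3 := h j (f j).1
      rwa [Finset.sum_eq_zero, add_zero] at h3
      intro i hi
      refine h1 i ?_
      have := Finset.mem_of_mem_erase hi
      rwa [maskSet, if_pos rfl, if_neg hj] at this
  funext j l
  have h3 := h j l
  rwa [Finset.sum_eq_zero fun i _ => h2 i, add_zero] at h3

theorem separates_maskedSelection (R : Finset (Fin D)) (f : Fin D → Fin L × Finset (Fin D))
    (e : Fin N ≃ Option (Fin D × Fin L)) :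
    Separates.{u} fun n => maskedSelection R f (e n) := by
  intro M _ X y h
  have hy : y = 0 := by
    have := h (e.symm none)
    simpa [maskedSelection, selectSum] using this
  refine eq_zero_of_maskedSelection R f X fun j l => ?_
  have := h (e.symm (some (j, l)))
  simpa only [hy, add_zero, e.apply_symm_apply] using this

/-- The event becomes a condition on each `f i` separately, so its probability factors under a
product law. -/
theorem maskedSelection_eq_iff (R : Finset (Fin D)) (f : Fin D → Fin L × Finset (Fin D))
    {v : Fin D → Option (Fin L)} {j : Fin D} {l : Fin L} (hv : v j = some l)
    {B : Finset (Fin D)} (hB : ∀ i, i ∈ B ↔ i ≠ j ∧ v i ≠ none) (hj : j ∉ (f j).2) :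
    maskedSelection R f (some (j, l)) = v
      ↔ ∀ i, if i = j then maskSet R f j l = B else i ∈ B → v i = some (f i).1 := by
  have hjB : j ∉ B := fun h => ((hB j).1 h).1 rfl
  have hjm : j ∉ maskSet R f j l := by
    rw [maskSet]
    split_ifs with h1 h2
    · simp
    · exact h2
    · exact hj
  constructor
  · intro h
    have hm : maskSet R f j l = B := by
      ext i
      rw [hB, ← h]
      by_cases hij : i = j
      · simp [hij, hjm]
      · by_cases hi : i ∈ maskSet R f j l <;> simp [maskedSelection, hij, hi]
    intro i
    split_ifs with hij
    · exact hm
    · intro hi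
      rw [← h]
      simp [maskedSelection, hij, hm, hi]
  · intro h
    have hm : maskSet R f j l = B := by simpa using h j
    funext i
    by_cases hij : i = j
    · simp [maskedSelection, hij, hv]
    · have hi := h i
      rw [if_neg hij] at hi
      by_cases hiB : i ∈ B
      · simp [maskedSelection, hij, hm, hiB, hi hiB]
      · have : v i = none := by
          by_contra hc
          exact hiB ((hB i).2 ⟨hij, hc⟩)
        simp [maskedSelection, hij, hm, hiB, this]

theorem sum_prod_maskedSelection (hL : 0 < L) {m : Fin D → Finset (Fin D) → ℝ}
    (hm1 : ∀ j, ∑ B, m j B = 1) (hm0 : ∀ j B, j ∈ B → m j B = 0) (R : Finset (Fin D))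
    {v : Fin D → Option (Fin L)} {j : Fin D} {l : Fin L} (hv : v j = some l)
    {B : Finset (Fin D)} (hB : ∀ i, i ∈ B ↔ i ≠ j ∧ v i ≠ none) :
    ∑ f : Fin D → Fin L × Finset (Fin D),
        (if maskedSelection R f (some (j, l)) = v then ∏ i, (L : ℝ)⁻¹ * m i (f i).2 else 0)
      = (L : ℝ)⁻¹ ^ (B.card + 1)
        * ((if (if j ∈ R then ∅ else R) = B then 1 else 0) + (L - 1) * m j B) := by
  classical
  have hL0 : (L : ℝ) ≠ 0 := by exact_mod_cast hL.ne'
  have hjB : j ∉ B := fun h => ((hB j).1 h).1 rfl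
  let c : Fin D → Fin L × Finset (Fin D) → Prop := fun i z =>
    if i = j then (if l = z.1 then (if j ∈ R then ∅ else R) else z.2) = B
    else i ∈ B → v i = some z.1
  have hterm : ∀ f : Fin D → Fin L × Finset (Fin D),
      (if maskedSelection R f (some (j, l)) = v then ∏ i, (L : ℝ)⁻¹ * m i (f i).2 else 0)
        = ∏ i, (if c i (f i) then (L : ℝ)⁻¹ * m i (f i).2 else 0) := by
    intro f
    -- If a mask contains its own message, both sides have the factor `m j (f j).2 = 0`; otherwise
    -- the coordinatewise criterion applies.
    by_cases hj : j ∈ (f j).2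
    · have h0 : ∏ i, (L : ℝ)⁻¹ * m i (f i).2 = 0 :=
        Finset.prod_eq_zero (Finset.mem_univ j) (by rw [hm0 j _ hj, mul_zero])
      rw [h0, ite_self, eq_comm]
      refine Finset.prod_eq_zero (Finset.mem_univ j) ?_
      rw [hm0 j _ hj, mul_zero, ite_self]
    · have hiff : maskedSelection R f (some (j, l)) = v ↔ ∀ i, c i (f i) := by
        rw [maskedSelection_eq_iff R f hv hB hj]
        refine forall_congr' fun i => ?_
        by_cases hij : i = j
        · subst hij
          simp [c, maskSet]
        · simp [c, hij]
      by_cases hall : ∀ i, c i (f i)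
      · rw [if_pos (hiff.2 hall)]
        exact Finset.prod_congr rfl fun i _ => (if_pos (hall i)).symm
      · rw [if_neg fun h => hall (hiff.1 h)]
        obtain ⟨i, hi⟩ := not_forall.1 hall
        exact (Finset.prod_eq_zero (Finset.mem_univ i) (if_neg hi)).symm
  have hfac : ∀ i, i ≠ j → ∑ z, (if c i z then (L : ℝ)⁻¹ * m i z.2 else 0)
      = if i ∈ B then (L : ℝ)⁻¹ else 1 := by
    intro i hij
    rw [Fintype.sum_prod_type]
    by_cases hi : i ∈ B
    · obtain ⟨k, hk⟩ := Option.ne_none_iff_exists'.1 ((hB i).1 hi).2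
      simp only [c, hij, hi, hk, if_false, true_implies, if_true, Option.some.injEq]
      rw [Finset.sum_eq_single k]
      · simp [← Finset.mul_sum, hm1]
      · intro b _ hb
        simp [Ne.symm hb]
      · simp
    · simp [c, hij, hi, ← Finset.mul_sum, hm1, hL0]
  -- With probability `1 / L` the subpacket `l` is the reference of message `j` and its mask comes
  -- from `R`; for the other `L - 1` references its mask has law `m j`.
  have hfacj : ∑ z, (if c j z then (L : ℝ)⁻¹ * m j z.2 else 0)
      = (L : ℝ)⁻¹ * ((if (if j ∈ R then ∅ else R) = B then 1 else 0) + (L - 1) * m j B) := by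
    rw [Fintype.sum_prod_type, ← Finset.add_sum_erase _ _ (Finset.mem_univ l)]
    have h1 : ∑ C, (if c j (l, C) then (L : ℝ)⁻¹ * m j C else 0)
        = (L : ℝ)⁻¹ * if (if j ∈ R then ∅ else R) = B then 1 else 0 := by
      simp only [c, if_true]
      split_ifs <;> simp [← Finset.mul_sum, hm1]
    have h2 : ∀ k ∈ Finset.univ.erase l, ∑ C, (if c j (k, C) then (L : ℝ)⁻¹ * m j C else 0)
        = (L : ℝ)⁻¹ * m j B := by
      intro k hk
      simp [c, (Finset.ne_of_mem_erase hk).symm]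
    rw [h1, Finset.sum_congr rfl h2, Finset.sum_const, Finset.card_erase_of_mem (Finset.mem_univ l),
      Finset.card_univ, Fintype.card_fin, nsmul_eq_mul, Nat.cast_sub hL, Nat.cast_one]
    ring
  simp only [hterm]
  rw [← Fintype.prod_sum (fun i z => if c i z then (L : ℝ)⁻¹ * m i z.2 else 0),
    ← Finset.mul_prod_erase _ _ (Finset.mem_univ j), hfacj,
    Finset.prod_congr rfl fun i hi => hfac i (Finset.ne_of_mem_erase hi)]
  have : Finset.filter (fun i => i ∈ B) (Finset.univ.erase j) = B := by
    ext i
    simp only [Finset.mem_filter, Finset.mem_erase, Finset.mem_univ, and_true]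
    exact ⟨fun h => h.2, fun h => ⟨fun hij => hjB (hij ▸ h), h⟩⟩
  rw [← Finset.prod_filter, this, Finset.prod_const, pow_succ]
  ring

/-- The finitely supported law with real weights `w`. -/
noncomputable def realPMF {ι : Type*} [Fintype ι] (w : ι → ℝ) (hw : ∀ i, 0 ≤ w i)
    (h1 : ∑ i, w i = 1) : PMF ι :=
  PMF.ofFintype (fun i => ENNReal.ofReal (w i)) <| by
    rw [← ENNReal.ofReal_sum_of_nonneg fun i _ => hw i, h1, ENNReal.ofReal_one]

theorem realPMF_apply {ι : Type*} [Fintype ι] (w : ι → ℝ) (hw : ∀ i, 0 ≤ w i)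
    (h1 : ∑ i, w i = 1) (i : ι) : realPMF w hw h1 i = ENNReal.ofReal (w i) := rfl

theorem realPMF_map_apply {ι α : Type*} [Fintype ι] [DecidableEq α] (w : ι → ℝ)
    (hw : ∀ i, 0 ≤ w i) (h1 : ∑ i, w i = 1) (g : ι → α) (a : α) :
    (realPMF w hw h1).map g a = ENNReal.ofReal (∑ i, if g i = a then w i else 0) := by
  classical
  rw [PMF.map_apply, tsum_fintype, ENNReal.ofReal_sum_of_nonneg]
  · refine Finset.sum_congr rfl fun i _ => ?_
    by_cases h : g i = a
    · simp [h, realPMF_apply]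
    · simp [h, Ne.symm h]
  · intro i _
    split_ifs
    · exact hw i
    · exact le_rfl

/-- The weight of a selection from one message: `none` has weight `(1 + r)⁻¹`. -/
noncomputable def selectionWeight (r : ℝ) : Option (Fin L) → ℝ
  | none => (1 + r)⁻¹
  | some _ => (1 + r)⁻¹ * (r / L)

theorem prod_selectionWeight {ι : Type*} [Fintype ι] (r : ℝ) (v : ι → Option (Fin L)) :
    ∏ i, selectionWeight r (v i)
      = (1 + r)⁻¹ ^ Fintype.card ι * (r / L) ^ (Finset.univ.filter fun i => v i ≠ none).card := by
  have : ∀ i, selectionWeight r (v i) = (1 + r)⁻¹ * if v i ≠ none then r / L else 1 := by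
    intro i
    cases v i <;> simp [selectionWeight]
  simp only [this, Finset.prod_mul_distrib, Finset.prod_const, Finset.card_univ]
  rw [← Finset.prod_filter, Finset.prod_const]

/-- A random family of selections, one for each server, that always separates the subpackets of
`D` messages and each of whose members consists of independent selections from the messages. -/
theorem exists_separating_ensemble (hD : 0 < D) (hL : 0 < L) (hN : N = D * L + 1) {r : ℝ}
    (hr : 0 ≤ r) (hrD : (1 + r) ^ D = N) :
    ∃ p : PMF (Fin N → Fin D → Option (Fin L)),
      (∀ a ∈ p.support, Separates.{u} a)
      ∧ ∀ n v, p.map (fun a => a n) v = ENNReal.ofReal (∏ j, selectionWeight r (v j)) := by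
  classical
  have hL0 : (L : ℝ) ≠ 0 := by exact_mod_cast hL.ne'
  have hN0 : (N : ℝ) ≠ 0 := by rw [hN]; positivity
  have : NeZero N := ⟨by omega⟩
  have hrD' : (1 + r) ^ D = D * L + 1 := by rw [hrD, hN]; push_cast; ring
  obtain ⟨p, m, hp, hp1, hm, hm1, hm0, hpm⟩ := exists_subset_laws hD hL hr hrD'
  have e : Fin N ≃ Option (Fin D × Fin L) := Fintype.equivOfCardEq (by simp [hN])
  let Ω := Fin N × Finset (Fin D) × (Fin D → Fin L × Finset (Fin D))
  let w : Ω → ℝ := fun ω => (N : ℝ)⁻¹ * (p ω.2.1 * ∏ i, (L : ℝ)⁻¹ * m i (ω.2.2 i).2)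
  -- A uniform cyclic shift of the servers gives them all the same marginal, namely the average over
  -- the roles `none` and `some (j, l)`.
  let a : Ω → Fin N → Fin D → Option (Fin L) := fun ω n =>
    maskedSelection ω.2.1 ω.2.2 (e (n + ω.1))
  have hw : ∀ ω, 0 ≤ w ω := fun ω => mul_nonneg (by positivity) <| mul_nonneg (hp _) <|
    Finset.prod_nonneg fun i _ => mul_nonneg (by positivity) (hm _ _)
  have hf1 : ∑ f : Fin D → Fin L × Finset (Fin D), ∏ i, (L : ℝ)⁻¹ * m i (f i).2 = 1 := by
    rw [← Fintype.prod_sum (fun i (z : Fin L × Finset (Fin D)) => (L : ℝ)⁻¹ * m i z.2)]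
    refine Finset.prod_eq_one fun i _ => ?_
    simp [Fintype.sum_prod_type, ← Finset.mul_sum, hm1, hL0]
  have hw1 : ∑ ω, w ω = 1 := by
    simp only [w, Ω, Fintype.sum_prod_type, ← Finset.mul_sum, hf1, mul_one, hp1]
    simp [hN0]
  refine ⟨(realPMF w hw hw1).map a, ?_, ?_⟩
  · intro b hb
    obtain ⟨ω, -, rfl⟩ := (PMF.mem_support_map_iff _ _ _).1 hb
    exact separates_maskedSelection ω.2.1 ω.2.2 ((Equiv.addRight ω.1).trans e)
  · intro n v
    rw [PMF.map_comp, realPMF_map_apply]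
    congr 1
    let q : Option (Fin D × Fin L) → ℝ := fun x => ∑ R, p R *
      ∑ f : Fin D → Fin L × Finset (Fin D),
        if maskedSelection R f x = v then ∏ i, (L : ℝ)⁻¹ * m i (f i).2 else 0
    have hq : (∑ ω, if ((fun a => a n) ∘ a) ω = v then w ω else 0) = (N : ℝ)⁻¹ * ∑ x, q x := by
      rw [← Equiv.sum_comp ((Equiv.addLeft n).trans e) q, Finset.mul_sum]
      simp only [Ω, Fintype.sum_prod_type, q, Finset.mul_sum]
      refine Finset.sum_congr rfl fun s _ => Finset.sum_congr rfl fun R _ =>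
        Finset.sum_congr rfl fun f _ => ?_
      simp only [a, w, Function.comp_apply, Equiv.trans_apply, Equiv.coe_addLeft]
      by_cases h : maskedSelection R f (e (n + s)) = v <;> simp [h]
    rw [hq, prod_selectionWeight, Fintype.card_fin, inv_pow, hrD]
    congr 1
    set A := Finset.univ.filter fun i => v i ≠ none with hA
    have hnone : q none = if A = ∅ then 1 else 0 := by
      have hv : (∀ f R, maskedSelection (L := L) R f none = v ↔ A = ∅) := by
        intro f R
        rw [hA, Finset.filter_eq_empty_iff, funext_iff]
        simp [maskedSelection, eq_comm]
      simp only [q, hv]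
      split_ifs
      · simp [hf1, hp1]
      · simp
    -- The role `(j, l)` can produce `v` only if `v j = some l`. Each of the `A.card` such roles
    -- contributes equally, which cancels the denominator from `exists_subset_laws`.
    have hsome : ∀ j, ∑ l, q (some (j, l))
        = if j ∈ A then (r / L) ^ A.card / A.card else 0 := by
      intro j
      by_cases hj : v j = none
      · have hjA : j ∉ A := by simp [hA, hj]
        rw [if_neg hjA]
        refine Finset.sum_eq_zero fun l _ => Finset.sum_eq_zero fun R _ => ?_
        rw [Finset.sum_eq_zero, mul_zero]
        intro f _
        refine if_neg fun h => ?_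
        rw [← h] at hj
        simp [maskedSelection] at hj
      · have hjA : j ∈ A := by simp [hA, hj]
        obtain ⟨l, hl⟩ := Option.ne_none_iff_exists'.1 hj
        have hB : ∀ i, i ∈ A.erase j ↔ i ≠ j ∧ v i ≠ none := by
          intro i
          simp [hA]
        have hcard : (A.erase j).card + 1 = A.card := Finset.card_erase_add_one hjA
        have hc : ((A.erase j).card : ℝ) + 1 = A.card := by exact_mod_cast hcard
        rw [if_pos hjA, Finset.sum_eq_single l]
        · simp only [q, sum_prod_maskedSelection hL hm1 hm0 _ hl hB]
          have hpm' := hpm j (A.erase j) (Finset.notMem_erase j A)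
          rw [hc, hcard] at hpm'
          have hR : ∀ (x y : ℝ) (R : Finset (Fin D)),
              p R * (x * ((if (if j ∈ R then ∅ else R) = A.erase j then 1 else 0) + y))
                = x * ((if (if j ∈ R then ∅ else R) = A.erase j then p R else 0) + p R * y) := by
            intro x y R
            split_ifs <;> ring
          simp only [hR]
          rw [← Finset.mul_sum, Finset.sum_add_distrib, ← Finset.sum_mul, hp1, one_mul, hpm',
            hcard, div_pow, inv_pow]
          ring
        · intro l' _ hl'
          refine Finset.sum_eq_zero fun R _ => ?_
          rw [Finset.sum_eq_zero, mul_zero]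
          intro f _
          refine if_neg fun h => hl' ?_
          rw [← h] at hl
          simpa [maskedSelection] using hl
        · simp
    rw [Fintype.sum_option, Fintype.sum_prod_type, hnone, Finset.sum_congr rfl fun j _ => hsome j,
      ← Finset.sum_filter, Finset.sum_const, nsmul_eq_mul, Finset.filter_mem_eq_inter,
      Finset.univ_inter]
    by_cases hA0 : A = ∅
    · simp [hA0]
    · have : (A.card : ℝ) ≠ 0 := by exact_mod_cast (Finset.card_pos.2
        (Finset.nonempty_iff_ne_empty.2 hA0)).ne'
      rw [if_neg hA0, zero_add, mul_div_cancel₀ _ this]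

end Ensemble

/-! ### Product laws and their resampling on the demand -/

section Product

/-- The law of a family of independent random variables with law `ν`. -/
noncomputable def productPMF {V : Type*} [Fintype V] (ι : Type*) [Fintype ι] [DecidableEq ι]
    (ν : PMF V) : PMF (ι → V) :=
  PMF.ofFintype (fun v => ∏ i, ν (v i)) <| by
    rw [← Fintype.prod_sum (fun _ => ν)]
    refine Finset.prod_eq_one fun i _ => ?_
    rw [← tsum_fintype (L := .unconditional _), ν.tsum_coe]

theorem productPMF_apply {V : Type*} [Fintype V] {ι : Type*} [Fintype ι] [DecidableEq ι]
    (ν : PMF V) (v : ι → V) : productPMF ι ν v = ∏ i, ν (v i) := rfl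

variable {K D : ℕ} {V : Type*}

/-- The family with the entries of `v` at the indices in `W` and those of `t` elsewhere. -/
def overwrite (W : Demand K D) (v : Fin D → V) (t : Fin K → V) (k : Fin K) : V :=
  if h : k ∈ W.1 then v ((W.1.orderIsoOfFin W.2).symm ⟨k, h⟩) else t k

theorem overwrite_orderIsoOfFin (W : Demand K D) (v : Fin D → V) (t : Fin K → V) (j : Fin D) :
    overwrite W v t (W.1.orderIsoOfFin W.2 j) = v j := by
  rw [overwrite, dif_pos (W.1.orderIsoOfFin W.2 j).2]
  exact congrArg v ((W.1.orderIsoOfFin W.2).symm_apply_apply j)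

theorem prod_orderIsoOfFin {M : Type*} [CommMonoid M] (W : Demand K D) (g : Fin K → M) :
    ∏ j, g (W.1.orderIsoOfFin W.2 j) = ∏ k ∈ W.1, g k := by
  exact ((W.1.orderIsoOfFin W.2).toEquiv.prod_comp fun k : W.1 => g k).trans
    (Finset.prod_coe_sort W.1 g)

theorem sum_orderIsoOfFin {M : Type*} [AddCommMonoid M] (W : Demand K D) (g : Fin K → M) :
    ∑ j, g (W.1.orderIsoOfFin W.2 j) = ∑ k ∈ W.1, g k := by
  exact ((W.1.orderIsoOfFin W.2).toEquiv.sum_comp fun k : W.1 => g k).trans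
    (Finset.sum_coe_sort W.1 g)

/-- Replacing some coordinates of an independent family by fresh independent ones preserves its law.
This hides the position of the demand from each server. -/
theorem productPMF_bind_overwrite [Fintype V] (ν : PMF V) (W : Demand K D) :
    ((productPMF (Fin D) ν).bind fun v => (productPMF (Fin K) ν).map (overwrite W v))
      = productPMF (Fin K) ν := by
  classical
  ext q
  have hiff : ∀ v t, q = overwrite W v t
      ↔ v = (fun j => q (W.1.orderIsoOfFin W.2 j)) ∧ ∀ k, k ∈ W.1 ∨ q k = t k := by
    intro v t
    constructor
    · rintro rfl
      refine ⟨funext fun j => (overwrite_orderIsoOfFin W v t j).symm, fun k => ?_⟩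
      by_cases hk : k ∈ W.1
      · exact Or.inl hk
      · exact Or.inr (dif_neg hk)
    · rintro ⟨rfl, h⟩
      funext k
      by_cases hk : k ∈ W.1
      · simp [overwrite, hk]
      · rw [overwrite, dif_neg hk]
        exact (h k).resolve_left hk
  have hsum : ∑ t : Fin K → V, (if ∀ k, k ∈ W.1 ∨ q k = t k then ∏ k, ν (t k) else 0)
      = ∏ k, if k ∈ W.1 then 1 else ν (q k) := by
    have h1 : ∀ t : Fin K → V, (if ∀ k, k ∈ W.1 ∨ q k = t k then ∏ k, ν (t k) else 0)
        = ∏ k, if k ∈ W.1 ∨ q k = t k then ν (t k) else 0 := by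
      intro t
      by_cases h : ∀ k, k ∈ W.1 ∨ q k = t k
      · rw [if_pos h]
        exact Finset.prod_congr rfl fun k _ => (if_pos (h k)).symm
      · rw [if_neg h]
        obtain ⟨k, hk⟩ := not_forall.1 h
        exact (Finset.prod_eq_zero (Finset.mem_univ k) (if_neg hk)).symm
    simp only [h1]
    rw [← Fintype.prod_sum (fun k s => if k ∈ W.1 ∨ q k = s then ν s else 0)]
    refine Finset.prod_congr rfl fun k _ => ?_
    by_cases hk : k ∈ W.1
    · simp only [hk, true_or, if_true]
      rw [← tsum_fintype (L := .unconditional _), ν.tsum_coe]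
    · simp [hk]
  rw [PMF.bind_apply, tsum_eq_single fun j => q (W.1.orderIsoOfFin W.2 j)]
  · simp only [PMF.map_apply, hiff, true_and, productPMF_apply, tsum_fintype, hsum]
    rw [prod_orderIsoOfFin W fun k => ν (q k), ← Finset.prod_ite_mem_eq, ← Finset.prod_mul_distrib]
    refine Finset.prod_congr rfl fun k _ => ?_
    split_ifs <;> simp
  · intro v hv
    simp only [PMF.map_apply, hiff, hv, false_and, if_false, tsum_zero, mul_zero]

end Product

/-! ### Splitting a selection into demand and interference -/

section Selection

variable {K D L : ℕ}

theorem selectSum_overwrite {M : Type*} [AddCommGroup M] (W : Demand K D)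
    (v : Fin D → Option (Fin L)) (t : Fin K → Option (Fin L)) (X : Fin K → Fin L → M) :
    selectSum (overwrite W v t) X
      = selectSum v (fun j => X (W.1.orderIsoOfFin W.2 j))
        + ∑ k ∈ W.1ᶜ, (t k).elim 0 (X k) := by
  rw [selectSum, ← Finset.sum_add_sum_compl W.1,
    ← sum_orderIsoOfFin W fun k => (overwrite W v t k).elim 0 (X k)]
  simp only [overwrite_orderIsoOfFin]
  congr 1
  refine Finset.sum_congr rfl fun k hk => ?_
  rw [overwrite, dif_neg (Finset.mem_compl.1 hk)]

theorem selectSum_sub {ι M : Type*} [Fintype ι] [AddCommGroup M] (v : ι → Option (Fin L))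
    (X Y : ι → Fin L → M) : selectSum v (X - Y) = selectSum v X - selectSum v Y := by
  rw [selectSum, selectSum, selectSum, ← Finset.sum_sub_distrib]
  refine Finset.sum_congr rfl fun i _ => ?_
  cases v i <;> simp

end Selection

/-! ### The selection protocol -/

namespace LinearProtocol

variable {F : Type u} [Field F] {K D N L ℓ : ℕ}

/-- The protocol in which a query selects at most one subpacket of each message and is answered by
the sum of the selected subpackets, or by nothing if no subpacket is selected. The selections from
the demand messages are drawn from `p`; those from the other messages are the same for all servers
and independent with law `ν`. -/
noncomputable def selectionProtocol (F : Type u) [Field F] (K : ℕ)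
    (p : PMF (Fin N → Fin D → Option (Fin L))) (ν : PMF (Option (Fin L))) :
    LinearProtocol F K D N L where
  Query := Fin K → Option (Fin L)
  queryLaw W := p.bind fun a => (productPMF (Fin K) ν).map fun t n => overwrite W (a n) t
  coeffs _ q := open Classical in
    if q = fun _ => none then [] else [fun k l => if q k = some l then 1 else 0]

variable {p : PMF (Fin N → Fin D → Option (Fin L))} {ν : PMF (Option (Fin L))}

theorem selectSum_eq_of_answer_eq {n : Fin N} {q : Fin K → Option (Fin L)}
    {X Y : Messages F K L ℓ}
    (h : (selectionProtocol F K p ν).answer n q X = (selectionProtocol F K p ν).answer n q Y) :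
    selectSum q X = selectSum q Y := by
  by_cases hq : q = fun _ => none
  · subst hq
    simp [selectSum]
  · have hs : ∀ Z : Messages F K L ℓ,
        (selectionProtocol F K p ν).answer n q Z = [selectSum q Z] := by
      intro Z
      simp only [answer, selectionProtocol, if_neg hq, List.map_cons, List.map_nil, selectSum]
      congr 1
      refine Finset.sum_congr rfl fun k _ => ?_
      cases hk : q k <;> simp
    rw [hs, hs] at h
    exact List.singleton_injective h

theorem queryLaw_selectionProtocol_map (hp : ∀ n, p.map (fun a => a n) = productPMF (Fin D) ν)
    (n : Fin N) (W : Demand K D) :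
    ((selectionProtocol F K p ν).queryLaw W).map (fun Q => Q n) = productPMF (Fin K) ν := by
  rw [← productPMF_bind_overwrite ν W, ← hp n]
  simp only [selectionProtocol, PMF.map_bind, PMF.bind_map, PMF.map_comp, Function.comp_def]

theorem isRecoverable_selectionProtocol [Fintype F]
    (hp : ∀ a ∈ p.support, Separates.{u} a) : (selectionProtocol F K p ν).IsRecoverable ℓ := by
  rw [isRecoverable_iff]
  intro W Q hQ X Y h k hk
  obtain ⟨a, ha, hQ⟩ := (PMF.mem_support_bind_iff _ _ _).1 hQ
  obtain ⟨t, -, rfl⟩ := (PMF.mem_support_map_iff _ _ _).1 hQ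
  -- By linearity the difference of the two databases has zero answers. Its undemanded part is the
  -- same sum at every server, and serves as the unknown common summand in `Separates`.
  have h0 := hp a ha (Fin ℓ → F) (fun j => (X - Y) (W.1.orderIsoOfFin W.2 j))
    (∑ k ∈ W.1ᶜ, (t k).elim 0 ((X - Y) k)) fun n => by
      rw [← selectSum_overwrite, selectSum_sub, selectSum_eq_of_answer_eq (h n), sub_self]
  have h1 := congrFun h0 ((W.1.orderIsoOfFin W.2).symm ⟨k, hk⟩)
  simp only [OrderIso.apply_symm_apply] at h1
  exact sub_eq_zero.1 h1

theorem queryMarginal_selectionProtocol (hDK : D ≤ K)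
    (hp : ∀ n, p.map (fun a => a n) = productPMF (Fin D) ν) (n : Fin N) :
    (selectionProtocol F K p ν).queryMarginal hDK n = productPMF (Fin K) ν := by
  simp only [queryMarginal, queryLaw_selectionProtocol_map hp]
  exact PMF.bind_const _ _

theorem isPrivate_selectionProtocol [Fintype F] (hDK : D ≤ K)
    (hp : ∀ n, p.map (fun a => a n) = productPMF (Fin D) ν) :
    (selectionProtocol F K p ν).IsPrivate ℓ hDK := by
  rw [isPrivate_iff]
  intro n W
  rw [queryMarginal_selectionProtocol hDK hp, queryLaw_selectionProtocol_map hp]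

/-- An answer has at most `ℓ` symbols, and none for the empty query, whose probability is `ν none ^
K`. -/
theorem meanResidualRank_selectionProtocol_le [Fintype F] (hDK : D ≤ K)
    (hp : ∀ n, p.map (fun a => a n) = productPMF (Fin D) ν) :
    (selectionProtocol F K p ν).meanResidualRank ℓ hDK ∅ ≤ N * (ℓ * (1 - ν none ^ K)) := by
  classical
  have hrank : ∀ (n : Fin N) (q : Fin K → Option (Fin L)),
      (selectionProtocol F K p ν).residualRank ℓ n q ∅ ≤ if q = fun _ => none then 0 else ℓ := by
    intro n q
    unfold residualRank
    refine (Submodule.finrank_le _).trans ?_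
    rw [Module.finrank_pi_fintype]
    simp only [Module.finrank_fin_fun, Finset.sum_const, Finset.card_univ, Fintype.card_fin,
      smul_eq_mul]
    by_cases hq : q = fun _ => none <;> simp [selectionProtocol, hq]
  have hone : ∑' q : Fin K → Option (Fin L), productPMF (Fin K) ν q
      * ((if q = fun _ => none then 0 else ℓ : ℕ) : ℝ≥0∞) ≤ ℓ * (1 - ν none ^ K) := by
    have h0 : productPMF (Fin K) ν (fun _ => none) = ν none ^ K := by
      simp [productPMF_apply]
    have hsub : (ℓ : ℝ≥0∞) * (1 - ν none ^ K) = ℓ - ℓ * ν none ^ K := by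
      rw [ENNReal.mul_sub fun _ _ => ENNReal.natCast_ne_top ℓ, mul_one]
    rw [hsub]
    refine ENNReal.le_sub_of_add_le_right
      (ENNReal.mul_ne_top (ENNReal.natCast_ne_top ℓ) (ENNReal.pow_ne_top (PMF.apply_ne_top _ _))) ?_
    calc _ = ∑' q : Fin K → Option (Fin L), (productPMF (Fin K) ν q
            * ((if q = fun _ => none then 0 else ℓ : ℕ) : ℝ≥0∞)
            + if q = fun _ => none then ℓ * ν none ^ K else 0) := by
          rw [ENNReal.tsum_add, tsum_ite_eq]
      _ ≤ ∑' q : Fin K → Option (Fin L), productPMF (Fin K) ν q * ℓ := by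
          refine ENNReal.tsum_le_tsum fun q => ?_
          by_cases hq : q = fun _ => none
          · subst hq
            simp [h0, mul_comm]
          · simp [hq]
      _ = ℓ := by rw [ENNReal.tsum_mul_right, PMF.tsum_coe, one_mul]
  calc _ ≤ ∑ _n : Fin N, (ℓ : ℝ≥0∞) * (1 - ν none ^ K) := by
        refine Finset.sum_le_sum fun n _ => le_trans ?_ hone
        rw [queryMarginal_selectionProtocol hDK hp]
        exact ENNReal.tsum_le_tsum fun q => mul_le_mul_right (Nat.cast_le.2 (hrank n q)) _
    _ = _ := by simp

end LinearProtocol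

/-! ### The value of the capacity -/

theorem inv_geom_sum_eq_ofReal {N : ℕ} (hN : 1 < N) {j : ℕ} (hj : j ≠ 0) :
    (∑ i ∈ Finset.range j, (N : ℝ≥0∞)⁻¹ ^ i)⁻¹
      = ENNReal.ofReal ((1 - 1 / (N : ℝ)) / (1 - 1 / (N : ℝ) ^ j)) := by
  have hN1 : (1 : ℝ) < N := by exact_mod_cast hN
  have hN0 : (0 : ℝ) < N := by linarith
  have hpos : 0 < ∑ i ∈ Finset.range j, (N : ℝ)⁻¹ ^ i :=
    Finset.sum_pos (fun i _ => by positivity) (Finset.nonempty_range_iff.2 hj)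
  have hne : (N : ℝ)⁻¹ ≠ 1 := (inv_lt_one_of_one_lt₀ hN1).ne
  have hcast : ∑ i ∈ Finset.range j, (N : ℝ≥0∞)⁻¹ ^ i
      = ENNReal.ofReal (∑ i ∈ Finset.range j, (N : ℝ)⁻¹ ^ i) := by
    rw [ENNReal.ofReal_sum_of_nonneg fun i _ => by positivity]
    refine Finset.sum_congr rfl fun i _ => ?_
    rw [ENNReal.ofReal_pow (by positivity), ENNReal.ofReal_inv_of_pos hN0, ENNReal.ofReal_natCast]
  rw [hcast, ← ENNReal.ofReal_inv_of_pos hpos, geom_sum_eq hne, inv_div, ← neg_sub,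
    ← neg_sub (1 : ℝ) ((N : ℝ)⁻¹ ^ j), neg_div_neg_eq, inv_pow, one_div, one_div]

theorem le_capacity (F : Type u) [Field F] [Fintype F] {K D N L ℓ : ℕ} (hD : 0 < D) (hL : 0 < L)
    (hℓ : 0 < ℓ) (hDK : D ≤ K) (hdvd : D ∣ K) (hN : N = D * L + 1) :
    ENNReal.ofReal ((1 - 1 / (N : ℝ)) / (1 - 1 / (N : ℝ) ^ (K / D))) ≤ capacity F hDK N L ℓ := by
  have hDL : 0 < D * L := Nat.mul_pos hD hL
  have hN1 : (1 : ℝ) < N := by rw [hN]; exact_mod_cast Nat.lt_add_of_pos_left hDL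
  have hN0 : (0 : ℝ) < N := by linarith
  have hDL1 : ((D * L : ℕ) : ℝ) = N - 1 := by rw [hN]; push_cast; ring
  -- With `(1 + r) ^ D = N`, a selection from `D` messages is empty with probability `1 / N`, and
  -- one from all `K` messages with probability `1 / N ^ (K / D)`.
  set r : ℝ := (N : ℝ) ^ ((D : ℝ)⁻¹) - 1 with hr
  have hr0 : 0 ≤ r := sub_nonneg.2 (Real.one_le_rpow hN1.le (by positivity))
  have hrD : (1 + r) ^ D = N := by
    rw [hr, add_sub_cancel, Real.rpow_inv_natCast_pow hN0.le hD.ne']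
  obtain ⟨p, hsep, hmarg⟩ := exists_separating_ensemble.{u} hD hL hN hr0 hrD
  have hr1 : 0 < 1 + r := by linarith
  have hnn : ∀ o : Option (Fin L), 0 ≤ selectionWeight r o := by
    intro o
    cases o <;> simp only [selectionWeight] <;> positivity
  have hsum : ∑ o : Option (Fin L), selectionWeight r o = 1 := by
    have hL0 : (L : ℝ) ≠ 0 := by exact_mod_cast hL.ne'
    simp only [Fintype.sum_option, selectionWeight, Finset.sum_const, Finset.card_univ,
      Fintype.card_fin, nsmul_eq_mul]
    field_simp
  set ν : PMF (Option (Fin L)) := realPMF (selectionWeight r) hnn hsum with hν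
  have hp : ∀ n, p.map (fun a => a n) = productPMF (Fin D) ν := by
    intro n
    ext v
    rw [hmarg, productPMF_apply, ENNReal.ofReal_prod_of_nonneg fun j _ => hnn _]
    rfl
  have hν0 : ν none ^ K = ENNReal.ofReal (1 / (N : ℝ) ^ (K / D)) := by
    rw [hν, realPMF_apply, selectionWeight, ← ENNReal.ofReal_pow (by positivity)]
    obtain ⟨j, rfl⟩ := hdvd
    rw [Nat.mul_div_cancel_left j hD, pow_mul, inv_pow, hrD, inv_pow, one_div]
  have hK : K / D ≠ 0 := (Nat.div_pos hDK hD).ne'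
  have hx : 1 / (N : ℝ) ^ (K / D) < 1 := by
    rw [div_lt_one (by positivity)]
    exact one_lt_pow₀ hN1 hK
  have hrank := LinearProtocol.meanResidualRank_selectionProtocol_le (F := F) (ℓ := ℓ) hDK hp
  have hden : (N : ℝ≥0∞) * (ℓ * (1 - ν none ^ K))
      = ENNReal.ofReal (N * (ℓ * (1 - 1 / (N : ℝ) ^ (K / D)))) := by
    rw [hν0, ENNReal.ofReal_mul hN0.le, ENNReal.ofReal_mul (Nat.cast_nonneg ℓ),
      ENNReal.ofReal_sub _ (by positivity), ENNReal.ofReal_one, ENNReal.ofReal_natCast,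
      ENNReal.ofReal_natCast]
  have hℓ0 : (0 : ℝ) < ℓ := by exact_mod_cast hℓ
  have hx' := sub_pos.2 hx
  refine le_trans ?_ (le_iSup₂_of_le (LinearProtocol.selectionProtocol F K p ν)
    (LinearProtocol.isPrivate_selectionProtocol hDK hp)
    (le_iSup_of_le (LinearProtocol.isRecoverable_selectionProtocol hsep) le_rfl))
  rw [LinearProtocol.rate_eq]
  refine le_trans (le_of_eq ?_) (ENNReal.div_le_div_left hrank _)
  rw [hden, ← ENNReal.ofReal_natCast, ← ENNReal.ofReal_div_of_pos (by positivity), Nat.cast_mul,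
    hDL1]
  congr 1
  field_simp

end MPIR

theorem theorem2 (F : Type*) [Field F] [Fintype F] (K D N L ℓ : ℕ)
    (hD : 0 < D) (hL : 0 < L) (hℓ : 0 < ℓ) (hDK : D ≤ K) (hdvd : D ∣ K) (hN : N = D * L + 1) :
    MPIR.capacity F hDK N L ℓ
      = ENNReal.ofReal ((1 - 1 / (N : ℝ)) / (1 - 1 / (N : ℝ) ^ (K / D))) := by
  have hN1 : 1 < N := by
    have := Nat.mul_pos hD hL
    omega
  refine le_antisymm ?_ (MPIR.le_capacity F hD hL hℓ hDK hdvd hN)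
  rw [← MPIR.inv_geom_sum_eq_ofReal hN1 (Nat.div_pos hDK hD).ne']
  exact iSup₂_le fun P hpriv => iSup_le fun hrec =>
    P.rate_le hDK hpriv hrec (by omega) hD hdvd
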